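/- Let $p=7$ or $p=13$, and let $BP_*=\mathbb Z_{(p)}[v_1,v_2,\dots]\subset MU_*\otimes\mathbb Q$ with $v_k$ the Hazewinkel generators and $v_0=p$. A ring homomorphism $f\colon BP_*\to R$ makes $R$ a *Landweber exact algebra* if each $f(v_n)$, $n\ge 0$, is a non-zero-divisor on $R/(p,f(v_1),\dots,f(v_{n-1}))$; it has *height $n$* if moreover $R/(p,f(v_1),\dots,f(v_{n-1}))$ is nonzero and $f(v_n)$ is invertible in it. Let $\varphi^P\colon MU_*\otimes\mathbb Q\to\mathbb Q[G_2,G_3,G_4]$ be the genus whose logarithm satisfies $$\log_{\varphi^P}'(u)=(1+G_2u^6+G_3u^9+G_4u^{12})^{-1/3},$$ let $\Delta_C=16G_2^4G_4-4G_2^3G_3^2-128G_2^2G_4^2+144G_2G_3^2G_4-27G_3^4+256G_4^3$, and let $r\colon\mathbb Z_{(p)}[G_2,G_3,G_4]\to\mathbb Z_{(p)}[\kappa,\lambda]$ be the $\mathbb Z_{(p)}$-algebra homomorphism with $$r(G_2)=-\tfrac38\lambda+\tfrac{27}{2}\Delta_6,\qquad r(G_3)=\tfrac18\kappa\lambda,\qquad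 r(G_4)=-\tfrac1{256}\kappa^2(3\lambda+108\Delta_6),\qquad \Delta_6=\tfrac1{108}(\lambda-\kappa^2).$$ Then $\varphi^P(BP_*)\subset\mathbb Z_{(p)}[G_2,G_3,G_4]$, and: 1. $\varphi^P$ makes $\mathbb Z_{(p)}[G_2,G_3^{\pm1},G_4]$ a Landweber exact algebra of height three. 2. $r\circ\varphi^P$ makes $\mathbb Z_{(p)}[\kappa^{\pm1},\lambda^{\pm1}]$ a Landweber exact algebra of height two. 3. $r$ extends to a homomorphism of $BP_*$-algebras $$\mathbb Z_{(p)}[G_2,G_3^{\pm1},G_4]\to\mathbb Z_{(p)}[\kappa^{\pm1},\lambda^{\pm1}]$$ between these two Landweber exact algebras; it thus lowers the height by one. Moreover, writing $v_k$ also for $\varphi^P(v_k)$, in $\mathbb Z_{(p)}[G_2,G_3,G_4]$ one has $\Delta_C^{57}\equiv G_3^{228}\bmod(7,v_1,v_2)$ if $p=7$, and $v_3^{18}\equiv-G_3^{4392}\bmod(13,v_1,v_2)$ if $p=13$. -/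

import Mathlib

noncomputable section

namespace PicardTAF

/-! ### Complex bordism and Brown–Peterson coefficients -/

/-- The ring `ℤ_(p)` of rational numbers with denominator prime to `p`. -/
abbrev ZLocal (p : ℕ) [Fact p.Prime] : ValuationSubring ℚ :=
  (Rat.padicValuation p).valuationSubring

/-- The rational complex bordism ring `MU_* ⊗ ℚ = ℚ[[ℂP¹], [ℂP²], …]`; the variable `X n` is the
bordism class `[ℂP^(n+1)]`. -/
abbrev MURat : Type := MvPolynomial ℕ ℚ

/-- The class `[ℂPⁿ]`, where `[ℂP⁰] = 1`. -/
def cp : ℕ → MURat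
  | 0 => 1
  | n + 1 => MvPolynomial.X n

/-- The coefficient `ℓ_k = [ℂP^(p^k - 1)] / p^k` of `x^(p^k)` in the universal logarithm
`∑ n, [ℂPⁿ] x^(n+1) / (n+1)`. -/
def logCoeff (p k : ℕ) : MURat :=
  MvPolynomial.C ((1 : ℚ) / (p : ℚ) ^ k) * cp (p ^ k - 1)

/-- The Hazewinkel generators, determined by `v_0 = p` and
`p ℓ_n = v_n + ∑_{0 < i < n} ℓ_i v_{n-i}^(p^i)` for `n ≥ 1`. -/
def hazewinkel (p : ℕ) : ℕ → MURat
  | 0 => MvPolynomial.C (p : ℚ)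
  | n + 1 => MvPolynomial.C (p : ℚ) * logCoeff p (n + 1)
      - ∑ i : Fin n, logCoeff p (i + 1) * hazewinkel p (n - i) ^ p ^ ((i : ℕ) + 1)
  decreasing_by omega

/-- The coefficient ring `BP_* = ℤ_(p)[v_1, v_2, …]`, as a subring of `MU_* ⊗ ℚ`. -/
def BP (p : ℕ) [Fact p.Prime] : Subalgebra (ZLocal p) MURat :=
  Algebra.adjoin (ZLocal p) (Set.range fun n : ℕ => hazewinkel p (n + 1))

/-- The elements `v_0 = p, v_1, v_2, …` of `BP_*`. -/
def BP.v (p : ℕ) [Fact p.Prime] : ℕ → BP p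
  | 0 => (p : BP p)
  | n + 1 => ⟨hazewinkel p (n + 1), Algebra.subset_adjoin ⟨n, rfl⟩⟩

/-- The rational genus `MU_* ⊗ ℚ → A` whose logarithm has derivative `L` (a power series with
constant coefficient `1`): it sends `[ℂPⁿ]` to the coefficient of `uⁿ` in `L`. -/
def rationalGenus {A : Type*} [CommRing A] [Algebra ℚ A] (L : PowerSeries A) : MURat →ₐ[ℚ] A :=
  MvPolynomial.aeval fun n => PowerSeries.coeff (n + 1) L

/-! ### Landweber exactness -/

/-- `f : BP_* → R` makes `R` a Landweber exact algebra: for every `n` the sequence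
`v_0 = p, v_1, …, v_{n-1}` acts on `R` as a regular sequence, in the sense that each `v_i` is a
non-zero-divisor on `R / (p, v_1, …, v_{i-1})`. -/
def IsLandweberExact {p : ℕ} [Fact p.Prime] {R : Type*} [CommRing R] (f : BP p →+* R) : Prop :=
  ∀ n : ℕ, RingTheory.Sequence.IsWeaklyRegular R (List.ofFn fun i : Fin n => f (BP.v p i))

/-- The ideal `(p, v_1, …, v_{n-1})` of `R`. -/
def landweberIdeal {p : ℕ} [Fact p.Prime] {R : Type*} [CommRing R] (f : BP p →+* R) (n : ℕ) :
    Ideal R :=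
  Ideal.span (Set.range fun i : Fin n => f (BP.v p i))

/-- `f : BP_* → R` makes `R` a Landweber exact algebra of height (exactly) `n`: moreover
`R / (p, v_1, …, v_{n-1})` is nonzero and `v_n` is invertible in it. -/
structure IsLandweberExactOfHeight {p : ℕ} [Fact p.Prime] {R : Type*} [CommRing R]
    (f : BP p →+* R) (n : ℕ) : Prop where
  exact : IsLandweberExact f
  ne_top : landweberIdeal f n ≠ ⊤
  isUnit : IsUnit (Ideal.Quotient.mk (landweberIdeal f n) (f (BP.v p n)))

/-! ### The polynomial rings, the Picard genus and the restriction map -/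

/-- The polynomial ring `R[G₂, G₃, G₄]`. -/
abbrev GRing (R : Type*) [CommRing R] : Type _ := MvPolynomial (Fin 3) R

/-- The polynomial ring `R[κ, λ]`. -/
abbrev KLRing (R : Type*) [CommRing R] : Type _ := MvPolynomial (Fin 2) R

section
variable (R : Type*) [CommRing R]

/-- The generator `G₂`. -/
def G2 : GRing R := MvPolynomial.X 0
/-- The generator `G₃`. -/
def G3 : GRing R := MvPolynomial.X 1
/-- The generator `G₄`. -/
def G4 : GRing R := MvPolynomial.X 2

/-- The generator `κ`. -/
def kap : KLRing R := MvPolynomial.X 0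
/-- The generator `λ`. -/
def lam : KLRing R := MvPolynomial.X 1

/-- The form `Δ₆ = (λ - κ²) / 108` (for rings `R` in which `6` is invertible). -/
def delta6 : KLRing R := MvPolynomial.C (Ring.inverse 108) * (lam R - kap R ^ 2)

/-- The discriminant of the Picard family `y³ = x⁴ + G₂ x² + G₃ x + G₄`. -/
def deltaC : GRing R :=
  16 * G2 R ^ 4 * G4 R - 4 * G2 R ^ 3 * G3 R ^ 2 - 128 * G2 R ^ 2 * G4 R ^ 2
    + 144 * G2 R * G3 R ^ 2 * G4 R - 27 * G3 R ^ 4 + 256 * G4 R ^ 3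

/-- The restriction map `r : R[G₂, G₃, G₄] → R[κ, λ]` (for rings `R` in which `6` is invertible),
`G₂ ↦ -3/8 λ + 27/2 Δ₆`, `G₃ ↦ 1/8 κ λ`, `G₄ ↦ -1/256 κ² (3 λ + 108 Δ₆)`. -/
def restriction : GRing R →ₐ[R] KLRing R :=
  MvPolynomial.aeval
    ![-MvPolynomial.C (3 * Ring.inverse 8) * lam R
        + MvPolynomial.C (27 * Ring.inverse 2) * delta6 R,
      MvPolynomial.C (Ring.inverse 8) * kap R * lam R,
      -MvPolynomial.C (Ring.inverse 256) * kap R ^ 2 * (3 * lam R + 108 * delta6 R)]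

/-- `R[G₂, G₃^{±1}, G₄]`. -/
abbrev GRingLoc : Type _ := Localization.Away (G3 R)

/-- `R[κ^{±1}, λ^{±1}]`. -/
abbrev KLRingLoc : Type _ := Localization.Away (kap R * lam R)

end

/-- The power series `G₂ u⁶ + G₃ u⁹ + G₄ u¹²`. -/
def picardSeries : PowerSeries (GRing ℚ) :=
  PowerSeries.C (G2 ℚ) * PowerSeries.X ^ 6 + PowerSeries.C (G3 ℚ) * PowerSeries.X ^ 9
    + PowerSeries.C (G4 ℚ) * PowerSeries.X ^ 12

/-- The derivative `(1 + G₂ u⁶ + G₃ u⁹ + G₄ u¹²)^(-1/3)` of the logarithm of the Picard genus,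
obtained by substitution into the binomial series `(1 + X)^(-1/3)`. -/
def picardLogDeriv : PowerSeries (GRing ℚ) :=
  (PowerSeries.binomialSeries (GRing ℚ) (-1 / 3 : ℚ)).subst picardSeries

/-- The rational Picard genus `φ^P : MU_* ⊗ ℚ → ℚ[G₂, G₃, G₄]`. -/
def picardGenus : MURat →ₐ[ℚ] GRing ℚ := rationalGenus picardLogDeriv

/-- The inclusion `ℤ_(p)[G₂, G₃, G₄] → ℚ[G₂, G₃, G₄]`. -/
def toRat (p : ℕ) [Fact p.Prime] : GRing (ZLocal p) →+* GRing ℚ :=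
  MvPolynomial.map (algebraMap (ZLocal p) ℚ)

end PicardTAF

end

open PicardTAF

section
open Finset PowerSeries

/-! ### Dwork-type congruences for a lift of Frobenius -/

section FrobeniusLift
variable {R : Type*} [CommRing R] {p : ℕ} (ψ : R →+* R)

/-! Integrality. Put `f = 1 + G₂u⁶ + G₃u⁹ + G₄u¹²` and `y = f^(-1/3)`, the derivative of the
logarithm. As `p ≡ 1 mod 3`, the truncations `a n = f^((p^n - 1)/3)` satisfy `a n * y^(p^n) = y`.
Let `ψ` be the lift of Frobenius that raises `u` and the `Gᵢ` to their `p`-th powers. Expanding `a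
(n+1) = ∑ G k * ψ^(k+1)(a (n-k))` defines series `G k` divisible by `p^k` (`pow_dvd_ghost`), and `y
≡ ∑ G k * ψ^(k+1)(y)` modulo `p^(n+1)` (`pow_dvd_sub_sum_ghost`). In the coefficient of
`u^(p^(n+1)-1)` each summand contributes a single product, because `G k` has degree at most
`4(p^(k+1)-1)` and `y` is a series in `u³`. The result is a functional equation of Hazewinkel's type
(`exists_functional_equation`), which makes the images of the Hazewinkel generators integral
(`pow_dvd_hazewinkel_step`).

Reduction modulo `v₁`. Up to a unit, `v₁` is `G₂` for `p = 7` and `2G₂² - 3G₄` for `p = 13`, so a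
retraction `s` of the polynomial ring eliminates one variable (`PicardReduction`). With `t = u³`,
everything is then weighted homogeneous in the remaining variable `x` and in `z = G₃` of weight `3`.
Setting `z = 1` turns the coefficients of `y`, multiplied by `n!`, into the integer polynomials
`recPoly`. Since `v₁` is killed, the coefficients of index `p² - 1` and `p³ - 1` reduce to `p v₂`
and `p² v₃`. Computing `recPoly` modulo a suitable power of `p` therefore determines `v₂` and `v₃`
modulo `(p, v₁)`.

Height three. Up to a unit `v₂` becomes a monic polynomial `D` in `x`, and a kernel computation
shows that a power of `v₃` is constant modulo `(p, D)`. Homogenized by `homEval_pow_eq`, this says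
that a power of `v₃` is a unit times a power of `G₃` modulo `(p, v₁, v₂)`, hence `v₃` is invertible
once `G₃` is. The sequence `p, v₁, v₂` is regular because `p` is prime in the polynomial ring, `p ∤
v₁`, and `p ∤ s(v₂)`. The congruence for `Δ_C` follows from the explicit `v₂` for `p = 7`.

Height two. At a point with values in a field of characteristic `p` where `κ`, `λ` are nonzero and
`v₁` vanishes, `λ` is one of finitely many constants times `κ²`. By homogeneity `v₂` is then a power
of `κ` times a constant, and that constant is checked to be nonzero modulo `p`. -/

theorem iterate_dvd_sub {f : R} {d : ℕ} (hf : (d : R) ∣ f ^ p - ψ f) (k : ℕ) :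
    (d : R) ∣ (ψ^[k] f) ^ p - ψ (ψ^[k] f) := by
  obtain ⟨c, hc⟩ := hf
  refine ⟨ψ^[k] c, ?_⟩
  have h := congrArg (ψ^[k]) hc
  rwa [← RingHom.coe_pow, map_sub, map_mul, map_pow, map_natCast, RingHom.coe_pow,
    ← Function.iterate_succ_apply, Function.iterate_succ_apply'] at h

/-- Raising a congruence modulo `p` to the power `p^m` improves it to one modulo `p^(m+1)`. Every
`p`-adic estimate below rests on this one. -/
theorem pow_dvd_pow_sub_iterate {f : R} (hf : (p : R) ∣ f ^ p - ψ f) (k m : ℕ) :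
    (p : R) ^ (m + 1) ∣ f ^ p ^ (m + k) - (ψ^[k] f) ^ p ^ m := by
  induction k generalizing m with
  | zero => simp
  | succ k ih =>
    have h1 : (p : R) ^ (m + 1) ∣ f ^ p ^ (m + 1 + k) - (ψ^[k] f) ^ p ^ (m + 1) :=
      (pow_dvd_pow _ (by omega)).trans (ih (m + 1))
    have h2 := dvd_sub_pow_of_dvd_sub (iterate_dvd_sub ψ hf k) m
    rw [← pow_mul, ← pow_succ', ← Function.iterate_succ_apply' (⇑ψ)] at h2
    have := dvd_add h1 h2
    rw [sub_add_sub_cancel] at this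
    rwa [show m + (k + 1) = m + 1 + k by omega]

theorem dvd_pow_sub_add [hp : Fact p.Prime] {f g : R} (hf : (p : R) ∣ f ^ p - ψ f) (hg : (p : R) ∣ g ^ p - ψ g) :
    (p : R) ∣ (f + g) ^ p - ψ (f + g) := by
  obtain ⟨r, hr⟩ := exists_add_pow_prime_eq hp.out f g
  rw [hr, map_add, show f ^ p + g ^ p + p * f * g * r - (ψ f + ψ g) =
    (f ^ p - ψ f) + (g ^ p - ψ g) + p * (f * g * r) by ring]
  exact dvd_add (dvd_add hf hg) (dvd_mul_right _ _)

theorem dvd_pow_sub_mul {f g : R} (hf : (p : R) ∣ f ^ p - ψ f) (hg : (p : R) ∣ g ^ p - ψ g) :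
    (p : R) ∣ (f * g) ^ p - ψ (f * g) := by
  rw [map_mul, mul_pow, show f ^ p * g ^ p - ψ f * ψ g =
    f ^ p * (g ^ p - ψ g) + (f ^ p - ψ f) * ψ g by ring]
  exact dvd_add (hg.mul_left _) (hf.mul_right _)

theorem dvd_pow_sub_pow {f : R} (hf : (p : R) ∣ f ^ p - ψ f) (n : ℕ) :
    (p : R) ∣ (f ^ n) ^ p - ψ (f ^ n) := by
  rw [map_pow, ← pow_mul, mul_comm, pow_mul]
  exact hf.trans (sub_dvd_pow_sub_pow _ _ _)

/-- The solution `G` of the triangular system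
`a (n + 1) = ∑ k ≤ n, G k * ψ^(k+1) (a (n - k))`. -/
def ghost (a : ℕ → R) : ℕ → R
  | n => a (n + 1) - ∑ k : Fin n, ghost a k * ψ^[k + 1] (a (n - k))
  decreasing_by omega

theorem ghost_spec {a : ℕ → R} (ha : a 0 = 1) (n : ℕ) :
    a (n + 1) = ∑ k ∈ range (n + 1), ghost ψ a k * ψ^[k + 1] (a (n - k)) := by
  rw [sum_range_succ, Nat.sub_self, ha, iterate_map_one, mul_one]
  conv_rhs => rw [ghost]
  rw [Fin.sum_univ_eq_sum_range (fun k => ghost ψ a k * ψ^[k + 1] (a (n - k)))]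
  ring

/-- Comparing the expansion of `a (n+2)` with that of `a (n+1)` times `b^(p^(n+1))` writes `ghost ψ
a (n+1)` through earlier terms, each multiplied by a difference of the kind bounded in
`pow_dvd_pow_sub_iterate`. -/
theorem pow_dvd_ghost {b : R} (hb : (p : R) ∣ b ^ p - ψ b) {a : ℕ → R} (ha : a 0 = 1)
    (hs : ∀ n, a (n + 1) = a n * b ^ p ^ n) (n : ℕ) : (p : R) ^ n ∣ ghost ψ a n := by
  induction n using Nat.strong_induction_on with
  | _ n ih =>
    obtain _ | n := n
    · simp
    have h1 := ghost_spec ψ ha (n + 1)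
    rw [sum_range_succ, Nat.sub_self, ha, iterate_map_one, mul_one, hs (n + 1),
      ghost_spec ψ ha n, sum_mul] at h1
    have h2 : ghost ψ a (n + 1) = ∑ k ∈ range (n + 1), ghost ψ a k *
        (ψ^[k + 1] (a (n - k)) * (b ^ p ^ (n + 1) - (ψ^[k + 1] b) ^ p ^ (n - k))) := by
      rw [← sub_eq_iff_eq_add', ← sum_sub_distrib] at h1
      rw [← h1]
      refine sum_congr rfl fun k hk => ?_
      have hk' := mem_range.1 hk
      rw [show n + 1 - k = n - k + 1 by omega, hs (n - k), iterate_map_mul, iterate_map_pow]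
      ring
    rw [h2]
    refine dvd_sum fun k hk => ?_
    have hk' := mem_range.1 hk
    have h3 := pow_dvd_pow_sub_iterate ψ hb (k + 1) (n - k)
    rw [show n - k + (k + 1) = n + 1 by omega] at h3
    rw [show n + 1 = k + (n - k + 1) by omega, pow_add]
    rw [show k + (n - k + 1) = n + 1 by omega]
    exact mul_dvd_mul (ih k hk') (h3.mul_left _)

/-- Multiply the expansion of `a (n+1)` by `y^(p^(n+1))`. Replacing this factor by `(ψ^[k+1]
y)^(p^(n-k))` turns the `k`-th term into `ghost ψ a k * ψ^[k+1] y`, at the cost of a multiple of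
`p^(n-k+1)`; the factor `p^k` of `ghost ψ a k` supplies the rest. -/
theorem pow_dvd_sub_sum_ghost {b y : R} (hb : (p : R) ∣ b ^ p - ψ b) (hy : (p : R) ∣ y ^ p - ψ y)
    {a : ℕ → R} (ha : a 0 = 1) (hs : ∀ n, a (n + 1) = a n * b ^ p ^ n)
    (hay : ∀ n, a n * y ^ p ^ n = y) (n : ℕ) :
    (p : R) ^ (n + 1) ∣ y - ∑ k ∈ range (n + 1), ghost ψ a k * ψ^[k + 1] y := by
  have h : y - ∑ k ∈ range (n + 1), ghost ψ a k * ψ^[k + 1] y = ∑ k ∈ range (n + 1),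
      ghost ψ a k * (ψ^[k + 1] (a (n - k)) * (y ^ p ^ (n + 1) - (ψ^[k + 1] y) ^ p ^ (n - k))) := by
    have h0 := hay (n + 1)
    rw [ghost_spec ψ ha n, sum_mul] at h0
    nth_rw 1 [← h0]
    rw [← sum_sub_distrib]
    refine sum_congr rfl fun k hk => ?_
    have hk2 : ψ^[k + 1] (a (n - k)) * (ψ^[k + 1] y) ^ p ^ (n - k) = ψ^[k + 1] y := by
      rw [← iterate_map_pow, ← iterate_map_mul, hay]
    linear_combination ghost ψ a k * hk2
  rw [h]
  refine dvd_sum fun k hk => ?_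
  have hk' := mem_range.1 hk
  have h3 := pow_dvd_pow_sub_iterate ψ hy (k + 1) (n - k)
  rw [show n - k + (k + 1) = n + 1 by omega] at h3
  rw [show (p : R) ^ (n + 1) = p ^ k * p ^ (n - k + 1) by rw [← pow_add]; congr 1; omega]
  exact mul_dvd_mul (pow_dvd_ghost ψ hb ha hs k) (h3.mul_left _)

/-- The functional equation for a sequence `c n = p ^ n * ℓ n` of logarithm coefficients makes
the Hazewinkel generators integral. -/
theorem pow_dvd_hazewinkel_step (hψ : ∀ r : R, (p : R) ∣ r ^ p - ψ r) {c w s v : ℕ → R}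
    (hc : ∀ n, c (n + 1) = ∑ k ∈ range (n + 1), (p : R) ^ k * w k * ψ^[k + 1] (c (n - k))
      + p ^ (n + 1) * s n) (n : ℕ)
    (hv : ∀ m < n, c (m + 1) = ∑ i ∈ range (m + 1), (p : R) ^ (m - i) * c i * v (m - i) ^ p ^ i) :
    (p : R) ^ n ∣ c (n + 1) -
      ∑ i ∈ range n, (p : R) ^ (n - 1 - i) * c (i + 1) * v (n - 1 - i) ^ p ^ (i + 1) := by
  -- Here `v m` plays the role of the generator `v_(m+1)`. Expand `c (i + 1)` by the functional
  -- equation and move the powers of `v` inside `ψ^[k + 1]`; the error terms are divisible by `p^n`.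
  have h1 : (p : R) ^ n ∣
      ∑ i ∈ range n, (p : R) ^ (n - 1 - i) * c (i + 1) * v (n - 1 - i) ^ p ^ (i + 1) -
      ∑ i ∈ range n, ∑ k ∈ range (i + 1), (p : R) ^ (n - 1 - i + k) * w k *
        ψ^[k + 1] (c (i - k) * v (n - 1 - i) ^ p ^ (i - k)) := by
    rw [← sum_sub_distrib]
    refine dvd_sum fun i hi => ?_
    have hi' := mem_range.1 hi
    have : (p : R) ^ (n - 1 - i) * c (i + 1) * v (n - 1 - i) ^ p ^ (i + 1) -
        ∑ k ∈ range (i + 1), (p : R) ^ (n - 1 - i + k) * w k *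
        ψ^[k + 1] (c (i - k) * v (n - 1 - i) ^ p ^ (i - k)) =
        (p : R) ^ (n - 1 - i + (i + 1)) * (s i * v (n - 1 - i) ^ p ^ (i + 1)) +
        ∑ k ∈ range (i + 1), (p : R) ^ (n - 1 - i + k) * (w k * ψ^[k + 1] (c (i - k)) *
        (v (n - 1 - i) ^ p ^ (i + 1) - (ψ^[k + 1] (v (n - 1 - i))) ^ p ^ (i - k))) := by
      rw [hc, mul_add, add_mul, add_sub_right_comm, add_comm, mul_sum, sum_mul, ← sum_sub_distrib]
      congr 1
      · rw [pow_add]; ring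
      · refine sum_congr rfl fun k _ => ?_
        rw [iterate_map_mul, iterate_map_pow, pow_add]
        ring
    rw [this]
    refine dvd_add ((pow_dvd_pow _ (by omega)).mul_right _) (dvd_sum fun k hk => ?_)
    have hk' := mem_range.1 hk
    have h3 := pow_dvd_pow_sub_iterate ψ (hψ (v (n - 1 - i))) (k + 1) (i - k)
    rw [show i - k + (k + 1) = i + 1 by omega] at h3
    rw [show (p : R) ^ n = p ^ (n - 1 - i + k) * p ^ (i - k + 1) by
      rw [← pow_add]; congr 1; omega]
    exact mul_dvd_mul_left _ (h3.mul_left _)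
  -- Exchanging the order of summation makes the inner sum the Hazewinkel recursion for `c (n - k)`,
  -- so the whole is the functional equation for `c (n + 1)` without its last terms.
  have h2 : ∑ i ∈ range n, ∑ k ∈ range (i + 1), (p : R) ^ (n - 1 - i + k) * w k *
        ψ^[k + 1] (c (i - k) * v (n - 1 - i) ^ p ^ (i - k)) =
      ∑ k ∈ range n, (p : R) ^ k * w k * ψ^[k + 1] (c (n - k)) := by
    have := sum_range_diag_flip n fun k l => (p : R) ^ (n - 1 - (k + l) + k) * w k *
        ψ^[k + 1] (c l * v (n - 1 - (k + l)) ^ p ^ l)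
    refine Eq.trans ?_ (this.trans ?_)
    · refine sum_congr rfl fun i hi => sum_congr rfl fun k hk => ?_
      have hk' := mem_range.1 hk
      rw [show k + (i - k) = i by omega]
    · refine sum_congr rfl fun k hk => ?_
      have hk' := mem_range.1 hk
      obtain ⟨m, rfl⟩ : ∃ m, n = k + m + 1 := ⟨n - k - 1, by omega⟩
      rw [show k + m + 1 - k = m + 1 by omega, hv m (by omega),
        ← RingHom.coe_pow, map_sum, mul_sum]
      refine sum_congr rfl fun l hl => ?_
      have hl' := mem_range.1 hl
      rw [show k + m + 1 - 1 - (k + l) = m - l by omega, mul_assoc ((p : R) ^ (m - l)), map_mul _ ((p : R) ^ (m - l)),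
        map_pow _ (p : R), map_natCast, pow_add]
      ring
  have h3 : (p : R) ^ n ∣ c (n + 1) - ∑ k ∈ range n, (p : R) ^ k * w k * ψ^[k + 1] (c (n - k)) := by
    rw [hc, sum_range_succ]
    exact ⟨w n * ψ^[n + 1] (c (n - n)) + p * s n, by ring⟩
  rw [h2] at h1
  have := dvd_sub h3 h1
  rwa [sub_sub, add_sub_cancel] at this

end FrobeniusLift

end

/-! ### Lifts of Frobenius on power series and the functional equation -/

section
open Finset PowerSeries

/-- Both `y^p` and `ψ y` are inverse cube roots, of `f^p` and `ψ f`. The difference of their cubes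
is divisible by `p`, and the second factor of that difference is a unit. -/
theorem dvd_pow_sub_of_cube_mul {p : ℕ} {R : Type*} [CommRing R] (ψ : R →+* R) {y f : R}
    (hf : (p : R) ∣ f ^ p - ψ f) (hyf : y ^ 3 * f = 1)
    (hu : IsUnit ((y ^ p) ^ 2 + y ^ p * ψ y + ψ y ^ 2)) : (p : R) ∣ y ^ p - ψ y := by
  have h1 : (y ^ p) ^ 3 * f ^ p = 1 := by rw [← pow_mul, mul_comm p, pow_mul, ← mul_pow, hyf, one_pow]
  have h2 : ψ y ^ 3 * ψ f = 1 := by rw [← map_pow, ← map_mul, hyf, map_one]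
  have h3 : (y ^ p - ψ y) * ((y ^ p) ^ 2 + y ^ p * ψ y + ψ y ^ 2) =
      -(f ^ p - ψ f) * ((y ^ p) ^ 3 * ψ y ^ 3) := by
    linear_combination ψ y ^ 3 * h1 - (y ^ p) ^ 3 * h2
  rw [← hu.dvd_mul_right, h3]
  exact (hf.neg_right).mul_right _

section FrobeniusSeries
variable {A : Type*} [CommRing A] {p : ℕ} [hp : Fact p.Prime] (σ : A →+* A)

variable (p) in
/-- The lift of Frobenius `u ↦ u ^ p` to `A⟦u⟧` that extends `σ`. -/
noncomputable def frobSeries : A⟦X⟧ →+* A⟦X⟧ :=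
  (PowerSeries.expand p hp.out.ne_zero).toRingHom.comp (PowerSeries.map σ)

theorem frobSeries_apply (f : A⟦X⟧) :
    frobSeries p σ f = PowerSeries.expand p hp.out.ne_zero (PowerSeries.map σ f) := rfl

theorem coeff_frobSeries (f : A⟦X⟧) (n : ℕ) :
    coeff n (frobSeries p σ f) = if p ∣ n then σ (coeff (n / p) f) else 0 := by
  rw [frobSeries_apply, coeff_expand, coeff_map]

theorem coeff_frobSeries_iterate (f : A⟦X⟧) (k n : ℕ) :
    coeff n ((frobSeries p σ)^[k] f) = if p ^ k ∣ n then σ^[k] (coeff (n / p ^ k) f) else 0 := by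
  induction k generalizing n with
  | zero => simp
  | succ k ih =>
    rw [Function.iterate_succ_apply', coeff_frobSeries, ih]
    have hp0 := hp.out.pos
    by_cases h : p ∣ n
    · obtain ⟨m, rfl⟩ := h
      rw [if_pos (dvd_mul_right _ _), Nat.mul_div_cancel_left _ hp0, pow_succ',
        Nat.mul_div_mul_left _ _ hp0, Function.iterate_succ_apply']
      simp only [Nat.mul_dvd_mul_iff_left hp0]
      split_ifs <;> simp
    · rw [if_neg h, if_neg fun h' => h ((dvd_pow_self p (Nat.succ_ne_zero k)).trans h')]

theorem dvd_pow_sub_frobSeries_C (hσ : ∀ a : A, (p : A) ∣ a ^ p - σ a) (a : A) :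
    (p : A⟦X⟧) ∣ C a ^ p - frobSeries p σ (C a) := by
  obtain ⟨d, hd⟩ := hσ a
  refine ⟨C d, ?_⟩
  rw [frobSeries_apply, map_C, expand_C, ← map_pow, ← map_sub, hd, map_mul, map_natCast]

theorem dvd_pow_sub_frobSeries_X : (p : A⟦X⟧) ∣ X ^ p - frobSeries p σ X := by
  rw [frobSeries_apply, map_X, expand_X, sub_self]
  exact dvd_zero _

/-- The series `1 + g₂ u⁶ + g₃ u⁹ + g₄ u¹²`. -/
noncomputable def quarticSeries (g2 g3 g4 : A) : A⟦X⟧ := 1 + C g2 * X ^ 6 + C g3 * X ^ 9 + C g4 * X ^ 12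

theorem dvd_pow_sub_frobSeries_quartic (hσ : ∀ a : A, (p : A) ∣ a ^ p - σ a) (g2 g3 g4 : A) :
    (p : A⟦X⟧) ∣ quarticSeries g2 g3 g4 ^ p - frobSeries p σ (quarticSeries g2 g3 g4) := by
  have h (a : A) (n : ℕ) := dvd_pow_sub_mul (frobSeries p σ) (dvd_pow_sub_frobSeries_C σ hσ a)
    (dvd_pow_sub_pow (frobSeries p σ) (dvd_pow_sub_frobSeries_X σ) n)
  refine dvd_pow_sub_add _ (dvd_pow_sub_add _ (dvd_pow_sub_add _ ?_ (h _ _)) (h _ _)) (h _ _)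
  simp

theorem dvd_pow_sub_frobSeries_cubeRoot {y f : A⟦X⟧} (hf : (p : A⟦X⟧) ∣ f ^ p - frobSeries p σ f)
    (hyf : y ^ 3 * f = 1) (hy0 : constantCoeff y = 1) (h3 : IsUnit (3 : A)) :
    (p : A⟦X⟧) ∣ y ^ p - frobSeries p σ y := by
  refine dvd_pow_sub_of_cube_mul _ hf hyf ?_
  rw [isUnit_iff_constantCoeff]
  have : constantCoeff (frobSeries p σ y) = 1 := by
    rw [frobSeries_apply, constantCoeff_expand, ← coeff_zero_eq_constantCoeff_apply,
      coeff_map, coeff_zero_eq_constantCoeff_apply, hy0, map_one]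
  simp only [map_add, map_mul, map_pow, hy0, this]
  -- The constant coefficient of the second factor is `1 + 1 + 1`.
  norm_num
  exact h3

variable (A) in
/-- The power series of degree at most `d`. -/
def coeffVanishAbove (d : ℕ) : Submodule A A⟦X⟧ where
  carrier := {f | ∀ n, d < n → coeff n f = 0}
  add_mem' hf hg n hn := by rw [map_add, hf n hn, hg n hn, add_zero]
  zero_mem' n _ := by simp
  smul_mem' a f hf n hn := by rw [map_smul, hf n hn, smul_zero]

theorem mul_mem_coeffVanishAbove {f g : A⟦X⟧} {d e : ℕ} (hf : f ∈ coeffVanishAbove A d)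
    (hg : g ∈ coeffVanishAbove A e) : f * g ∈ coeffVanishAbove A (d + e) := by
  intro n hn
  rw [coeff_mul]
  refine sum_eq_zero fun x hx => ?_
  rw [HasAntidiagonal.mem_antidiagonal] at hx
  by_cases h : d < x.1
  · rw [hf _ h, zero_mul]
  · rw [hg _ (by omega), mul_zero]

theorem pow_mem_coeffVanishAbove {f : A⟦X⟧} {d : ℕ} (hf : f ∈ coeffVanishAbove A d) (n : ℕ) :
    f ^ n ∈ coeffVanishAbove A (d * n) := by
  induction n with
  | zero => intro n hn; rw [pow_zero, coeff_one, if_neg (by omega)]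
  | succ n ih => rw [pow_succ, mul_add, mul_one]; exact mul_mem_coeffVanishAbove ih hf

theorem frobSeries_iterate_mem_coeffVanishAbove {f : A⟦X⟧} {d : ℕ}
    (hf : f ∈ coeffVanishAbove A d) (k : ℕ) :
    (frobSeries p σ)^[k] f ∈ coeffVanishAbove A (p ^ k * d) := by
  intro n hn
  rw [coeff_frobSeries_iterate]
  split_ifs with h
  · obtain ⟨m, rfl⟩ := h
    have hpk : 0 < p ^ k := pow_pos hp.out.pos _
    rw [Nat.mul_div_cancel_left _ hpk, hf m (Nat.lt_of_mul_lt_mul_left hn), iterate_map_zero]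
  · rfl

theorem quarticSeries_mem_coeffVanishAbove (g2 g3 g4 : A) :
    quarticSeries g2 g3 g4 ∈ coeffVanishAbove A 12 := by
  intro n hn
  simp only [quarticSeries, map_add, coeff_one, coeff_C_mul, coeff_X_pow]
  rw [if_neg (by omega), if_neg (by omega), if_neg (by omega), if_neg (by omega)]
  simp

/-- The degrees fit exactly: `4(p^(k+1) - 1) + p^(k+1) * 4(p^(n-k) - 1) = 4(p^(n+1) - 1)`. -/
theorem ghost_mem_coeffVanishAbove {a : ℕ → A⟦X⟧}
    (ha : ∀ n, a n ∈ coeffVanishAbove A (4 * (p ^ n - 1))) (n : ℕ) :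
    ghost (frobSeries p σ) a n ∈ coeffVanishAbove A (4 * (p ^ (n + 1) - 1)) := by
  induction n using Nat.strong_induction_on with
  | _ n ih =>
    rw [ghost]
    refine Submodule.sub_mem _ (ha _) (Submodule.sum_mem _ fun k _ => ?_)
    have hk := k.2
    have h := mul_mem_coeffVanishAbove (ih k hk)
      (frobSeries_iterate_mem_coeffVanishAbove (p := p) σ (ha (n - k)) (k + 1))
    have h1 : p ^ (n + 1) = p ^ ((k : ℕ) + 1) * p ^ (n - k) := by rw [← pow_add]; congr 1; omega
    have h2 : 0 < p ^ ((k : ℕ) + 1) := pow_pos hp.out.pos _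
    have h3 : 0 < p ^ (n - k) := pow_pos hp.out.pos _
    convert h using 2
    rw [h1]
    obtain ⟨x, hx⟩ := Nat.exists_eq_add_of_lt h2
    obtain ⟨z, hz⟩ := Nat.exists_eq_add_of_lt h3
    rw [hx, hz]
    simp only [zero_add, Nat.add_sub_cancel]
    rw [show (x + 1) * (z + 1) = (x + (x + 1) * z) + 1 by ring, Nat.add_sub_cancel]
    ring

/-- Extraction of the coefficient of `u ^ (q * N - 1)`: of all the terms only one survives, for
reasons of degree and of divisibility by `3`. -/
theorem coeff_mul_frobSeries_iterate {g y : A⟦X⟧} (k N : ℕ) (hq : p ^ k % 3 = 1) (hN : N % 3 = 1)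
    (hg : g ∈ coeffVanishAbove A (4 * (p ^ k - 1))) (hy : ∀ n, ¬ 3 ∣ n → coeff n y = 0) :
    coeff (p ^ k * N - 1) (g * (frobSeries p σ)^[k] y) =
      coeff (p ^ k - 1) g * σ^[k] (coeff (N - 1) y) := by
  have hq0 : 0 < p ^ k := pow_pos hp.out.pos _
  obtain ⟨M, rfl⟩ : ∃ M, N = M + 1 := ⟨N - 1, by omega⟩
  rw [coeff_mul, sum_eq_single (p ^ k - 1, p ^ k * M)]
  · rw [coeff_frobSeries_iterate, if_pos (dvd_mul_right _ _), Nat.mul_div_cancel_left _ hq0,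
      Nat.add_sub_cancel]
  · rintro ⟨i, j⟩ hij hne
    rw [HasAntidiagonal.mem_antidiagonal] at hij
    dsimp only at hij ⊢
    rw [coeff_frobSeries_iterate]
    split_ifs with h
    · obtain ⟨m, rfl⟩ := h
      rw [Nat.mul_div_cancel_left _ hq0]
      -- With `q = p^k` one has `i = q(M - m) + q - 1`. If `3 ∣ m`, then `M - m` is a multiple of
      -- `3`; unless it is `0`, this gives `i ≥ 4q - 1`, beyond the degree of `g`.
      by_cases hm : 3 ∣ m
      · rw [hg i, zero_mul]
        obtain ⟨t, ht⟩ : ∃ t, M = m + t := by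
          refine Nat.exists_eq_add_of_le ?_
          by_contra! hlt
          have := Nat.mul_le_mul_left (p ^ k) (Nat.succ_le_of_lt hlt)
          rw [Nat.succ_eq_add_one, mul_add, mul_one] at this
          rw [mul_add, mul_one] at hij
          omega
        subst ht
        have ht3 : 3 ∣ t := by omega
        obtain ⟨t, rfl⟩ := ht3
        have hi : i = p ^ k * (3 * t) + p ^ k - 1 := by
          rw [mul_add, mul_add, mul_one] at hij
          omega
        obtain rfl | ht := Nat.eq_zero_or_pos t
        · refine absurd ?_ hne
          rw [hi]; simp
        · have : p ^ k * 3 ≤ p ^ k * (3 * t) := Nat.mul_le_mul_left _ (by omega)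
          omega
      · rw [hy m hm, iterate_map_zero, mul_zero]
    · rw [mul_zero]
  · intro h
    refine absurd (HasAntidiagonal.mem_antidiagonal.2 ?_) h
    dsimp only
    rw [mul_add]
    omega

/-- The functional equation of the logarithm coefficients `c n / p ^ n` of the genus with
logarithm `∫ (1 + g₂ u⁶ + g₃ u⁹ + g₄ u¹²) ^ (-1/3) du`. -/
theorem exists_functional_equation (hp3 : p % 3 = 1) (hσ : ∀ a : A, (p : A) ∣ a ^ p - σ a)
    (h3 : IsUnit (3 : A)) {g2 g3 g4 : A} {y : A⟦X⟧} (hyf : y ^ 3 * quarticSeries g2 g3 g4 = 1)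
    (hy0 : constantCoeff y = 1) (hy : ∀ n, ¬ 3 ∣ n → coeff n y = 0) :
    ∃ w s : ℕ → A, ∀ n, coeff (p ^ (n + 1) - 1) y =
      ∑ k ∈ range (n + 1), (p : A) ^ k * w k * σ^[k + 1] (coeff (p ^ (n - k) - 1) y)
        + p ^ (n + 1) * s n := by
  have hpow (n : ℕ) : p ^ n % 3 = 1 := by simp [Nat.pow_mod, hp3]
  set f := quarticSeries g2 g3 g4 with hf
  set a : ℕ → A⟦X⟧ := fun n => f ^ ((p ^ n - 1) / 3) with ha
  set b := f ^ ((p - 1) / 3) with hb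
  have hfp : (p : A⟦X⟧) ∣ f ^ p - frobSeries p σ f := dvd_pow_sub_frobSeries_quartic σ hσ _ _ _
  have hyp := dvd_pow_sub_frobSeries_cubeRoot σ hfp hyf hy0 h3
  have hbp := dvd_pow_sub_pow _ hfp ((p - 1) / 3)
  have ha0 : a 0 = 1 := by simp [ha]
  have has (n : ℕ) : a (n + 1) = a n * b ^ p ^ n := by
    simp only [ha, hb]
    rw [← pow_mul, ← pow_add]
    congr 1
    -- Here `p ≡ 1 mod 3` makes the exponents integral: `(p^(n+1) - 1)/3 = (p^n - 1)/3 + p^n (p -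
    -- 1)/3`.
    have h1 := hpow n
    obtain ⟨q, hq⟩ : ∃ q, p = 3 * q + 1 := ⟨p / 3, by omega⟩
    have h2 : p ^ (n + 1) = 3 * (q * p ^ n) + p ^ n := by rw [pow_succ]; nth_rw 2 [hq]; ring
    have h4 : (p - 1) / 3 = q := by omega
    rw [h2, h4]
    omega
  have hay (n : ℕ) : a n * y ^ p ^ n = y := by
    have h1 := hpow n
    have h2 : p ^ n = 3 * ((p ^ n - 1) / 3) + 1 := by omega
    simp only [ha]
    nth_rw 2 [h2]
    rw [pow_succ, pow_mul, ← mul_assoc, ← mul_pow, mul_comm f, hyf, one_pow, one_mul]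
  have hdeg (n : ℕ) : a n ∈ coeffVanishAbove A (4 * (p ^ n - 1)) := by
    have h1 := hpow n
    have := pow_mem_coeffVanishAbove (quarticSeries_mem_coeffVanishAbove g2 g3 g4) ((p ^ n - 1) / 3)
    convert this using 2
    omega
  have hw (k : ℕ) : ∃ w : A, coeff (p ^ (k + 1) - 1) (ghost (frobSeries p σ) a k) = p ^ k * w := by
    obtain ⟨d, hd⟩ := pow_dvd_ghost (frobSeries p σ) hbp ha0 has k
    refine ⟨coeff (p ^ (k + 1) - 1) d, ?_⟩
    rw [hd, show (p : A⟦X⟧) ^ k = C ((p : A) ^ k) by rw [map_pow, map_natCast], coeff_C_mul]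
  choose w hw using hw
  have hs (n : ℕ) : ∃ s : A, coeff (p ^ (n + 1) - 1) y -
      ∑ k ∈ range (n + 1), (p : A) ^ k * w k * σ^[k + 1] (coeff (p ^ (n - k) - 1) y) =
      p ^ (n + 1) * s := by
    obtain ⟨d, hd⟩ := pow_dvd_sub_sum_ghost (frobSeries p σ) hbp hyp ha0 has hay n
    refine ⟨coeff (p ^ (n + 1) - 1) d, ?_⟩
    have h1 := congrArg (coeff (p ^ (n + 1) - 1)) hd
    rw [show (p : A⟦X⟧) ^ (n + 1) = C ((p : A) ^ (n + 1)) by rw [map_pow, map_natCast],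
      coeff_C_mul, map_sub, map_sum] at h1
    rw [← h1]
    congr 1
    refine sum_congr rfl fun k hk => ?_
    have hk' := mem_range.1 hk
    have h2 : p ^ (n + 1) = p ^ (k + 1) * p ^ (n - k) := by rw [← pow_add]; congr 1; omega
    rw [← hw, h2, coeff_mul_frobSeries_iterate σ _ _ (hpow _) (hpow _)
      (ghost_mem_coeffVanishAbove σ hdeg k) hy]
  choose s hs using hs
  exact ⟨w, s, fun n => sub_eq_iff_eq_add'.1 (hs n)⟩

end FrobeniusSeries

end

section
open Finset PowerSeries

/-! ### Reduction of `ℤ_(p)` and of its polynomial ring modulo `p` -/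

section LocalIntegers
variable {p : ℕ} [hp : Fact p.Prime]

theorem ZLocal.norm_le_one (x : ZLocal p) : ‖((x : ℚ) : ℚ_[p])‖ ≤ 1 :=
  (Padic.norm_rat_le_one_iff_padicValuation_le_one p).2 x.2

variable (p) in
/-- The inclusion of `ℤ_(p)` into the `p`-adic integers. -/
noncomputable def ZLocal.toPadicInt : ZLocal p →+* ℤ_[p] where
  toFun x := ⟨((x : ℚ) : ℚ_[p]), ZLocal.norm_le_one x⟩
  map_one' := by apply Subtype.ext; simp
  map_mul' x y := Subtype.ext (by simp; rfl)
  map_zero' := by apply Subtype.ext; simp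
  map_add' x y := Subtype.ext (by simp; rfl)

variable (p) in
/-- Reduction modulo `p`. -/
noncomputable def ZLocal.toZMod : ZLocal p →+* ZMod p := PadicInt.toZMod.comp (ZLocal.toPadicInt p)

/-- The kernel of reduction on the `p`-adic integers is generated by `p`, and the quotient `x / p`
is still rational. Hence `p` is prime in `ℤ_(p)`, and divisibility by `p` can be tested over `ZMod
p`. -/
theorem ZLocal.toZMod_eq_zero_iff {x : ZLocal p} : ZLocal.toZMod p x = 0 ↔ (p : ZLocal p) ∣ x := by
  constructor
  · intro h
    have h1 : ZLocal.toPadicInt p x ∈ RingHom.ker (PadicInt.toZMod : ℤ_[p] →+* ZMod p) := h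
    rw [PadicInt.ker_toZMod, PadicInt.maximalIdeal_eq_span_p, Ideal.mem_span_singleton] at h1
    obtain ⟨u, hu⟩ := h1
    have hp0 : (p : ℚ) ≠ 0 := Nat.cast_ne_zero.2 hp.out.ne_zero
    have hu' : (((x : ℚ) / p : ℚ) : ℚ_[p]) = u := by
      have h2 := congrArg (fun t : ℤ_[p] => (t : ℚ_[p])) hu
      rw [PadicInt.coe_mul, PadicInt.coe_natCast] at h2
      change ((x : ℚ) : ℚ_[p]) = p * u at h2
      rw [Rat.cast_div, h2, Rat.cast_natCast,
        mul_div_cancel_left₀ _ (Nat.cast_ne_zero.2 hp.out.ne_zero)]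
    refine ⟨⟨(x : ℚ) / p, ?_⟩, ?_⟩
    · refine (Padic.norm_rat_le_one_iff_padicValuation_le_one p).1 ?_
      rw [hu']
      exact u.2
    · ext
      simp [mul_div_cancel₀ _ hp0]
  · rintro ⟨c, rfl⟩
    simp

theorem ZLocal.isUnit_natCast {n : ℕ} (hn : ¬ p ∣ n) : IsUnit (n : ZLocal p) := by
  have hn0 : (n : ℚ) ≠ 0 := Nat.cast_ne_zero.2 (by rintro rfl; exact hn (dvd_zero p))
  refine IsUnit.of_mul_eq_one ⟨(n : ℚ)⁻¹, ?_⟩ (by ext; simp [hn0])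
  refine Rat.padicValuation_le_one_iff.2 ?_
  rw [Rat.inv_natCast_den]
  split_ifs <;> simp_all

theorem ZLocal.prime_natCast : Prime (p : ZLocal p) := by
  refine ⟨Nat.cast_ne_zero.2 hp.out.ne_zero, fun h => ?_, fun a b h => ?_⟩
  · have := h.map (ZLocal.toZMod p)
    simp at this
  · simpa only [← ZLocal.toZMod_eq_zero_iff, map_mul, mul_eq_zero] using h

theorem GRing.isUnit_natCast {n : ℕ} (hn : ¬ p ∣ n) : IsUnit (n : GRing (ZLocal p)) := by
  have := (ZLocal.isUnit_natCast hn).map (MvPolynomial.C (σ := Fin 3))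
  rwa [map_natCast] at this

theorem GRing.natCast_dvd_iff {f : GRing (ZLocal p)} :
    (p : GRing (ZLocal p)) ∣ f ↔ MvPolynomial.map (ZLocal.toZMod p) f = 0 := by
  rw [← map_natCast (MvPolynomial.C (σ := Fin 3)), MvPolynomial.C_dvd_iff_dvd_coeff,
    MvPolynomial.ext_iff]
  simp only [MvPolynomial.coeff_map, ZLocal.toZMod_eq_zero_iff, MvPolynomial.coeff_zero]

/-- Over `ZMod p` the substitution of `p`-th powers of the variables is the Frobenius, so `expand p`
is a lift of Frobenius. -/
theorem GRing.dvd_pow_sub_expand (f : GRing (ZLocal p)) :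
    (p : GRing (ZLocal p)) ∣ f ^ p - MvPolynomial.expand p f := by
  rw [GRing.natCast_dvd_iff, map_sub, map_pow, MvPolynomial.map_expand, MvPolynomial.expand_zmod,
    sub_self]

theorem toRat_injective : Function.Injective (toRat p) :=
  MvPolynomial.map_injective _ Subtype.val_injective

@[simp] theorem toRat_G2 : toRat p (G2 _) = G2 ℚ := MvPolynomial.map_X _ _
@[simp] theorem toRat_G3 : toRat p (G3 _) = G3 ℚ := MvPolynomial.map_X _ _
@[simp] theorem toRat_G4 : toRat p (G4 _) = G4 ℚ := MvPolynomial.map_X _ _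

end LocalIntegers

/-! ### Coefficients of an inverse cube root -/

section CubeRoot
variable {A : Type*} [CommRing A]

/-- In the coefficient of degree `n` of `y³ f`, the top unknown enters linearly with factor `3`.
Thus each coefficient is determined by the earlier ones after division by `3`, which gives
integrality at `p ≠ 3`. -/
theorem three_mul_coeff_of_cube_mul {y f : A⟦X⟧} (hyf : y ^ 3 * f = 1)
    (hy0 : constantCoeff y = 1) (hf0 : constantCoeff f = 1) {n : ℕ} (hn : n ≠ 0) :
    3 * coeff n y = - coeff n ((trunc n y : A⟦X⟧) ^ 3 * f) := by
  obtain ⟨w, hw⟩ : (X : A⟦X⟧) ^ n ∣ y - (trunc n y : A⟦X⟧) := by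
    rw [X_pow_dvd_iff]
    intro m hm
    rw [map_sub, Polynomial.coeff_coe, coeff_trunc, if_pos hm, sub_self]
  set z : A⟦X⟧ := ((trunc n y : Polynomial A) : A⟦X⟧) with hz
  have hz0 : constantCoeff z = 1 := by
    rw [← coeff_zero_eq_constantCoeff_apply, hz, Polynomial.coeff_coe, coeff_trunc,
      if_pos (Nat.pos_of_ne_zero hn), coeff_zero_eq_constantCoeff_apply, hy0]
  have hyz : y = z + X ^ n * w := by rw [← hw]; ring
  have hw0 : constantCoeff w = coeff n y := by
    have h1 : coeff n z = 0 := by rw [hz, Polynomial.coeff_coe, coeff_trunc, if_neg (lt_irrefl _)]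
    have h2 := coeff_X_pow_mul w n 0
    rw [zero_add, coeff_zero_eq_constantCoeff_apply] at h2
    rw [hyz, map_add, h1, h2, zero_add]
  have h3 : z ^ 3 * f + X ^ n * (w * (3 * z ^ 2 + X ^ n * (3 * z * w + X ^ n * w ^ 2)) * f) = 1 := by
    rw [← hyf, hyz]; ring
  have h4 := congrArg (coeff n) h3
  have h5 := coeff_X_pow_mul (w * (3 * z ^ 2 + X ^ n * (3 * z * w + X ^ n * w ^ 2)) * f) n 0
  rw [zero_add, coeff_zero_eq_constantCoeff_apply] at h5
  rw [map_add, h5, coeff_one, if_neg hn] at h4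
  simp only [map_mul, map_add, map_pow, hw0, hz0, hf0, constantCoeff_X, zero_pow hn, map_ofNat] at h4
  linear_combination h4

theorem coeff_X_mul_derivative (y : A⟦X⟧) (n : ℕ) : coeff n (X * d⁄dX A y) = n * coeff n y := by
  cases n with
  | zero => simp
  | succ n => rw [coeff_succ_X_mul, coeff_derivative, mul_comm, Nat.cast_succ]

theorem three_mul_derivative_of_cube_mul {y f : A⟦X⟧} (hyf : y ^ 3 * f = 1) :
    3 * (d⁄dX A y * f) + y * d⁄dX A f = 0 := by
  have h := congrArg (d⁄dX A) hyf
  rw [derivative_one, Derivation.leibniz, derivative_pow] at h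
  simp only [smul_eq_mul] at h
  push_cast at h
  linear_combination (y * f) * h - (3 * (d⁄dX A y * f) + y * d⁄dX A f) * hyf

/-- The recurrence for the coefficients of `(1 + g₂ u⁶ + g₃ u⁹ + g₄ u¹²) ^ (-1/3)`. -/
theorem quartic_recurrence {y : A⟦X⟧} {g2 g3 g4 : A} (hyf : y ^ 3 * quarticSeries g2 g3 g4 = 1)
    (n : ℕ) : 3 * (n : A) * coeff n y
      + (if 6 ≤ n then (3 * ((n - 6 : ℕ) : A) + 6) * g2 * coeff (n - 6) y else 0)
      + (if 9 ≤ n then (3 * ((n - 9 : ℕ) : A) + 9) * g3 * coeff (n - 9) y else 0)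
      + (if 12 ≤ n then (3 * ((n - 12 : ℕ) : A) + 12) * g4 * coeff (n - 12) y else 0) = 0 := by
  have h1 : X * d⁄dX A (quarticSeries g2 g3 g4) =
      C (6 * g2) * X ^ 6 + C (9 * g3) * X ^ 9 + C (12 * g4) * X ^ 12 := by
    simp only [quarticSeries, map_add, Derivation.leibniz, derivative_one, derivative_C,
      derivative_pow, derivative_X, smul_eq_mul, map_mul, map_ofNat]
    push_cast
    ring
  have h2 : 3 * (X * d⁄dX A y) + X ^ 6 * (C g2 * (3 * (X * d⁄dX A y) + 6 * y))
      + X ^ 9 * (C g3 * (3 * (X * d⁄dX A y) + 9 * y))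
      + X ^ 12 * (C g4 * (3 * (X * d⁄dX A y) + 12 * y)) = 0 := by
    have h := three_mul_derivative_of_cube_mul hyf
    simp only [map_mul, map_ofNat] at h1
    have h' : quarticSeries g2 g3 g4 = 1 + C g2 * X ^ 6 + C g3 * X ^ 9 + C g4 * X ^ 12 := rfl
    linear_combination X * h - 3 * X * d⁄dX A y * h' - y * h1
  have h3 := congrArg (coeff n) h2
  have key (m : ℕ) (c : A) : coeff m (3 * (X * d⁄dX A y) + C c * y) = (3 * m + c) * coeff m y := by
    rw [map_add, coeff_C_mul, ← map_ofNat (C (R := A)) 3, coeff_C_mul, coeff_X_mul_derivative]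
    ring
  rw [map_add, map_add, map_add, map_zero, coeff_X_pow_mul', coeff_X_pow_mul', coeff_X_pow_mul',
    coeff_C_mul, coeff_C_mul, coeff_C_mul, ← map_ofNat (C (R := A)) 6, key,
    ← map_ofNat (C (R := A)) 9, key, ← map_ofNat (C (R := A)) 12, key,
    ← map_ofNat (C (R := A)) 3, coeff_C_mul, coeff_X_mul_derivative] at h3
  convert h3 using 2
  · congr 1
    · congr 1
      · ring
      · split_ifs <;> ring
    · split_ifs <;> ring
  · split_ifs <;> ring

/-- The recurrence links degrees that differ by `6`, `9` or `12` only. -/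
theorem coeff_eq_zero_of_not_three_dvd [IsDomain A] [CharZero A] {y : A⟦X⟧} {g2 g3 g4 : A}
    (hyf : y ^ 3 * quarticSeries g2 g3 g4 = 1) (n : ℕ) (hn : ¬ 3 ∣ n) : coeff n y = 0 := by
  induction n using Nat.strong_induction_on with
  | _ n ih =>
    have h := quartic_recurrence hyf n
    have hn0 : (n : A) ≠ 0 := Nat.cast_ne_zero.2 (by rintro rfl; exact hn (dvd_zero 3))
    have h6 (k : ℕ) (hk : 3 ∣ k) (hk0 : 0 < k) (h : k ≤ n) : coeff (n - k) y = 0 :=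
      ih _ (by omega) (by omega)
    have h3 : 3 * (n : A) * coeff n y = 0 := by
      rw [← h]
      split_ifs with h1 h2 h4 h2 h4 <;>
      simp [h6 6 (by decide) (by decide), h6 9 (by decide) (by decide),
        h6 12 (by decide) (by decide), *]
    simpa [hn0] using h3

end CubeRoot

end

section
open Finset PowerSeries

/-! ### Integrality of the Picard genus on `BP_*` -/

section PicardLogarithm

theorem one_add_picardSeries : 1 + picardSeries = quarticSeries (G2 ℚ) (G3 ℚ) (G4 ℚ) := by
  rw [picardSeries, quarticSeries]; ring

theorem constantCoeff_picardSeries : constantCoeff picardSeries = 0 := by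
  simp [picardSeries]

theorem hasSubst_picardSeries : HasSubst picardSeries :=
  HasSubst.of_constantCoeff_zero' constantCoeff_picardSeries

/-- Exponents of binomial series add, so the cube of `(1 + X)^(-1/3)` times `1 + X` is `1`; then
substitute the Picard series. -/
theorem picardLogDeriv_cube :
    picardLogDeriv ^ 3 * quarticSeries (G2 ℚ) (G3 ℚ) (G4 ℚ) = 1 := by
  have h1 : binomialSeries (GRing ℚ) (-1 / 3 : ℚ) ^ 3 * (1 + X) = 1 := by
    have h : (1 + X : (GRing ℚ)⟦X⟧) = binomialSeries (GRing ℚ) ((1 : ℕ) : ℚ) := by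
      rw [binomialSeries_nat, pow_one]
    rw [h, pow_succ, pow_two, ← binomialSeries_add, ← binomialSeries_add, ← binomialSeries_add]
    norm_num
  have h2 := congrArg (substAlgHom (R := GRing ℚ) hasSubst_picardSeries) h1
  rw [map_mul, map_pow, map_add, map_one, substAlgHom_X, one_add_picardSeries,
    coe_substAlgHom] at h2
  exact h2

theorem constantCoeff_picardLogDeriv : constantCoeff picardLogDeriv = 1 := by
  have h1 : picardLogDeriv = 1 + (binomialSeries (GRing ℚ) (-1 / 3 : ℚ) - 1).subst picardSeries := by
    have h : (1 : (GRing ℚ)⟦X⟧).subst picardSeries = 1 := by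
      rw [← coe_substAlgHom hasSubst_picardSeries, map_one]
    rw [subst_sub hasSubst_picardSeries, h]
    exact (add_sub_cancel _ _).symm
  rw [h1, map_add, map_one, add_eq_left]
  refine constantCoeff_subst_eq_zero constantCoeff_picardSeries _ ?_
  simp

variable {p : ℕ} [hp : Fact p.Prime]

theorem exists_map_eq {R S : Type*} [CommRing R] [CommRing S] (f : R →+* S) (y : S⟦X⟧)
    (hy : ∀ n, coeff n y ∈ f.range) : ∃ z : R⟦X⟧, PowerSeries.map f z = y := by
  choose a ha using hy
  exact ⟨PowerSeries.mk a, by ext n; rw [coeff_map, coeff_mk, ha]⟩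

theorem map_quarticSeries :
    PowerSeries.map (toRat p) (quarticSeries (G2 _) (G3 _) (G4 _)) =
      quarticSeries (G2 ℚ) (G3 ℚ) (G4 ℚ) := by
  simp [quarticSeries]

theorem coeff_picardLogDeriv_mem_range (hp3 : ¬ p ∣ 3) (n : ℕ) :
    coeff n picardLogDeriv ∈ (toRat p).range := by
  induction n using Nat.strong_induction_on with
  | _ n ih =>
    by_cases hn : n = 0
    · rw [hn, coeff_zero_eq_constantCoeff_apply, constantCoeff_picardLogDeriv]
      exact one_mem _
    have h := three_mul_coeff_of_cube_mul picardLogDeriv_cube constantCoeff_picardLogDeriv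
      (by simp [quarticSeries]) hn
    obtain ⟨z, hz⟩ := exists_map_eq (toRat p) (trunc n picardLogDeriv : (GRing ℚ)⟦X⟧) fun m => by
      rw [Polynomial.coeff_coe, coeff_trunc]
      split_ifs with hm
      · exact ih m hm
      · exact zero_mem _
    rw [← hz, ← map_quarticSeries (p := p), ← map_pow, ← map_mul, coeff_map] at h
    obtain ⟨u, hu⟩ := (GRing.isUnit_natCast hp3).exists_left_inv
    have h3 := congrArg (toRat p) hu
    rw [map_mul, map_natCast, map_one, Nat.cast_ofNat] at h3
    refine ⟨-(u * coeff n (z ^ 3 * quarticSeries (G2 _) (G3 _) (G4 _))), ?_⟩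
    rw [map_neg, map_mul]
    linear_combination (-toRat p u) * h + coeff n picardLogDeriv * h3

/-- The series `(1 + G₂ u⁶ + G₃ u⁹ + G₄ u¹²) ^ (-1/3)` over `ℤ_(p)[G₂, G₃, G₄]`. -/
theorem exists_integral_picardLogDeriv (hp3 : ¬ p ∣ 3) :
    ∃ y : (GRing (ZLocal p))⟦X⟧, PowerSeries.map (toRat p) y = picardLogDeriv ∧
      y ^ 3 * quarticSeries (G2 _) (G3 _) (G4 _) = 1 ∧ constantCoeff y = 1 := by
  obtain ⟨y, hy⟩ := exists_map_eq (toRat p) picardLogDeriv (coeff_picardLogDeriv_mem_range hp3)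
  refine ⟨y, hy, PowerSeries.map_injective (toRat p) toRat_injective ?_, toRat_injective ?_⟩
  · rw [map_mul, map_pow, hy, map_quarticSeries, picardLogDeriv_cube, map_one]
  · rw [← coeff_zero_eq_constantCoeff_apply, ← coeff_map, hy, coeff_zero_eq_constantCoeff_apply,
      constantCoeff_picardLogDeriv, map_one]

theorem picardGenus_cp (n : ℕ) : picardGenus (cp n) = coeff n picardLogDeriv := by
  cases n with
  | zero => rw [cp, map_one, coeff_zero_eq_constantCoeff_apply, constantCoeff_picardLogDeriv]
  | succ n => rw [cp, picardGenus, rationalGenus, MvPolynomial.aeval_X]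

theorem pow_mul_picardGenus_logCoeff (k : ℕ) :
    (p : GRing ℚ) ^ k * picardGenus (logCoeff p k) = coeff (p ^ k - 1) picardLogDeriv := by
  rw [logCoeff, map_mul, picardGenus_cp, ← MvPolynomial.algebraMap_eq, AlgHom.commutes,
    ← mul_assoc, ← map_natCast (algebraMap ℚ (GRing ℚ)), ← map_pow, ← map_mul,
    mul_one_div_cancel (pow_ne_zero _ (Nat.cast_ne_zero.2 hp.out.ne_zero)), map_one, one_mul]

/-- The recursion of the generators multiplied by `p^n`, so that the coefficients `p^i ℓ_i` of the
derivative replace the non-integral `ℓ_i`; the term `i = 0` contributes `p^n v_(n+1)`. -/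
theorem picardGenus_hazewinkel (n : ℕ) : coeff (p ^ (n + 1) - 1) picardLogDeriv =
    ∑ i ∈ range (n + 1), (p : GRing ℚ) ^ (n - i) * coeff (p ^ i - 1) picardLogDeriv *
      picardGenus (hazewinkel p (n - i + 1)) ^ p ^ i := by
  have h := congrArg picardGenus (hazewinkel.eq_2 p n)
  rw [map_sub, map_mul, map_sum] at h
  simp only [map_mul, map_pow] at h
  rw [← MvPolynomial.algebraMap_eq, AlgHom.commutes, map_natCast,
    Fin.sum_univ_eq_sum_range (fun i => picardGenus (logCoeff p (i + 1)) *
      picardGenus (hazewinkel p (n - i)) ^ p ^ (i + 1))] at h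
  rw [sum_range_succ', ← pow_mul_picardGenus_logCoeff]
  have h1 : ∑ k ∈ range n, (p : GRing ℚ) ^ (n - (k + 1)) *
      coeff (p ^ (k + 1) - 1) picardLogDeriv *
        picardGenus (hazewinkel p (n - (k + 1) + 1)) ^ p ^ (k + 1) =
      (p : GRing ℚ) ^ n * ∑ i ∈ range n, picardGenus (logCoeff p (i + 1)) *
        picardGenus (hazewinkel p (n - i)) ^ p ^ (i + 1) := by
    rw [mul_sum]
    refine sum_congr rfl fun k hk => ?_
    have hk' := mem_range.1 hk
    rw [← pow_mul_picardGenus_logCoeff, ← mul_assoc, ← pow_add,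
      show n - (k + 1) + 1 = n - k by omega, show n - (k + 1) + (k + 1) = n by omega, mul_assoc]
  rw [h1]
  simp only [Nat.sub_zero, pow_zero, Nat.sub_self, coeff_zero_eq_constantCoeff_apply,
    constantCoeff_picardLogDeriv, h]
  ring

theorem exists_toRat_eq_picardGenus_hazewinkel (hp3 : p % 3 = 1) (n : ℕ) :
    ∃ a, toRat p a = picardGenus (hazewinkel p (n + 1)) := by
  have hp3' : ¬ p ∣ 3 := fun h => by
    have := (Nat.prime_dvd_prime_iff_eq hp.out Nat.prime_three).1 h
    omega
  obtain ⟨y, hy, hy3, hy0⟩ := exists_integral_picardLogDeriv hp3'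
  have hc (m : ℕ) : coeff m picardLogDeriv = toRat p (coeff m y) := by rw [← hy, coeff_map]
  obtain ⟨σ, hσ⟩ : ∃ σ : GRing (ZLocal p) →+* GRing (ZLocal p),
      ∀ f, (p : GRing (ZLocal p)) ∣ f ^ p - σ f :=
    ⟨(MvPolynomial.expand p).toRingHom, GRing.dvd_pow_sub_expand⟩
  obtain ⟨w, s, hws⟩ := exists_functional_equation σ hp3 hσ (by exact_mod_cast GRing.isUnit_natCast hp3') hy3 hy0
    (coeff_eq_zero_of_not_three_dvd hy3)
  induction n using Nat.strong_induction_on with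
  | _ n ih =>
    choose! v hv using ih
    -- By induction the lower generators have integral images `v m`; the step shows that the
    -- remaining term `p^n v_(n+1)` is divisible by `p^n` over `ℤ_(p)`.
    have key := pow_dvd_hazewinkel_step σ hσ
      (c := fun k => coeff (p ^ k - 1) y) (v := v) hws n fun m hm => toRat_injective (by
        rw [← hc, picardGenus_hazewinkel, map_sum]
        refine sum_congr rfl fun i hi => ?_
        rw [map_mul, map_mul, map_pow, map_pow, map_natCast, ← hc, hv _ (by omega)])
    obtain ⟨a, ha⟩ := key
    refine ⟨a, ?_⟩
    have h1 := congrArg (toRat p) ha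
    have h2 := picardGenus_hazewinkel (p := p) n
    have hp0 : (p : GRing ℚ) ^ n ≠ 0 := pow_ne_zero _ (Nat.cast_ne_zero.2 hp.out.ne_zero)
    refine mul_left_cancel₀ hp0 ?_
    rw [map_mul, map_pow, map_natCast] at h1
    rw [← h1, map_sub, map_sum, ← hc, h2, sum_range_succ', add_sub_right_comm, ← sum_sub_distrib,
      sum_eq_zero]
    · simp [constantCoeff_picardLogDeriv]
    · intro i hi
      have hi' := mem_range.1 hi
      rw [map_mul, map_mul, map_pow, map_pow, map_natCast, ← hc, hv _ (by omega),
        show n - 1 - i = n - (i + 1) by omega, sub_self]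

variable (p) in
/-- The inclusion `ℤ_(p)[G₂, G₃, G₄] → ℚ[G₂, G₃, G₄]` as a map of algebras. -/
noncomputable def toRatAlgHom : GRing (ZLocal p) →ₐ[ZLocal p] GRing ℚ :=
  MvPolynomial.mapAlgHom (Algebra.ofId (ZLocal p) ℚ)

theorem picardGenus_mem_range (hp3 : p % 3 = 1) (x : BP p) :
    picardGenus (x : MURat) ∈ (toRatAlgHom p).range := by
  have h : BP p ≤ (toRatAlgHom p).range.comap (picardGenus.restrictScalars (ZLocal p)) := by
    refine Algebra.adjoin_le ?_
    rintro _ ⟨n, rfl⟩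
    exact exists_toRat_eq_picardGenus_hazewinkel hp3 n
  exact h x.2

/-- The Picard genus restricts to `BP_* → ℤ_(p)[G₂, G₃, G₄]`. -/
theorem exists_integral_picardGenus (hp3 : p % 3 = 1) :
    ∃ φ : BP p →ₐ[ZLocal p] GRing (ZLocal p), ∀ x : BP p, toRat p (φ x) = picardGenus (x : MURat) := by
  -- The image of `BP_*` lies in the range of the inclusion into the rational ring, on which the
  -- inclusion can be inverted.
  let e := AlgEquiv.ofInjective (toRatAlgHom p) toRat_injective
  refine ⟨e.symm.toAlgHom.comp ((((picardGenus.restrictScalars (ZLocal p)).comp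
    (BP p).val)).codRestrict _ (picardGenus_mem_range hp3)), fun x => ?_⟩
  have h := e.apply_symm_apply ⟨_, picardGenus_mem_range hp3 x⟩
  exact congrArg Subtype.val h

theorem hazewinkel_recursion {φ : BP p →ₐ[ZLocal p] GRing (ZLocal p)}
    (hφ : ∀ x : BP p, toRat p (φ x) = picardGenus (x : MURat)) {y : (GRing (ZLocal p))⟦X⟧}
    (hy : PowerSeries.map (toRat p) y = picardLogDeriv) (n : ℕ) :
    coeff (p ^ (n + 1) - 1) y = ∑ i ∈ range (n + 1), (p : GRing (ZLocal p)) ^ (n - i) *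
      coeff (p ^ i - 1) y * φ (BP.v p (n - i + 1)) ^ p ^ i := by
  apply toRat_injective
  rw [← coeff_map, hy, picardGenus_hazewinkel, map_sum]
  refine sum_congr rfl fun i _ => ?_
  rw [map_mul, map_mul, map_pow, map_pow, map_natCast, hφ, ← coeff_map, hy]
  rfl

end PicardLogarithm

end

/-! ### Polynomial arithmetic on coefficient lists for the kernel -/

section CoefficientLists

/-- `k n`, in a form that makes the kernel evaluate `n` first. -/
def force {α : Type} (n : ℕ) (k : ℕ → α) : α :=
  match n with
  | 0 => k 0
  | m + 1 => k (m + 1)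

theorem force_eq {α : Type} (n : ℕ) (k : ℕ → α) : force n k = k n := by
  cases n <;> rfl

/-- `k l`, in a form that makes the kernel evaluate `l` first. -/
def forceList {α : Type} : List ℕ → (List ℕ → α) → α
  | [], k => k []
  | x :: l, k => forceList l fun t => k (x :: t)

theorem forceList_eq {α : Type} (l : List ℕ) (k : List ℕ → α) : forceList l k = k l := by
  induction l generalizing k with
  | nil => rfl
  | cons x l ih => rw [forceList, ih]

/-- The coefficients of `c * f + g`, reduced modulo `M`. -/
def addMul (M c : ℕ) : List ℕ → List ℕ → List ℕ
  | [], l => l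
  | x :: f, [] => force (c * x % M) fun a => a :: addMul M c f []
  | x :: f, y :: g => force ((c * x + y) % M) fun a => a :: addMul M c f g

/-- The value at `ξ` of the polynomial with the given coefficients. -/
def evalList {R : Type*} [CommRing R] (ξ : R) (l : List ℕ) : R := l.foldr (fun (c : ℕ) (r : R) => c + ξ * r) 0

section Semantics
variable {R S : Type*} [CommRing R] [CommRing S]

@[simp] theorem evalList_nil (ξ : R) : evalList ξ [] = 0 := rfl

@[simp] theorem evalList_cons (ξ : R) (c : ℕ) (l : List ℕ) :
    evalList ξ (c :: l) = c + ξ * evalList ξ l := rfl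

theorem map_evalList (f : R →+* S) (ξ : R) (l : List ℕ) :
    f (evalList ξ l) = evalList (f ξ) l := by
  induction l with
  | nil => simp
  | cons c l ih => simp [ih]

theorem evalList_append (ξ : R) (l m : List ℕ) :
    evalList ξ (l ++ m) = evalList ξ l + ξ ^ l.length * evalList ξ m := by
  induction l with
  | nil => simp
  | cons c l ih => simp [ih, pow_succ]; ring

theorem evalList_replicate_append (ξ : R) (n : ℕ) (l : List ℕ) :
    evalList ξ (List.replicate n 0 ++ l) = ξ ^ n * evalList ξ l := by
  induction n with
  | zero => simp
  | succ n ih => rw [List.replicate_succ, List.cons_append, evalList_cons, ih]; push_cast; ring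

theorem natCast_mod_of_eq_zero {M : ℕ} (hM : (M : R) = 0) (n : ℕ) : ((n % M : ℕ) : R) = n := by
  conv_rhs => rw [← Nat.mod_add_div n M]
  rw [Nat.cast_add, Nat.cast_mul, hM, zero_mul, add_zero]

theorem evalList_addMul {M : ℕ} (hM : (M : R) = 0) (ξ : R) (c : ℕ) (l m : List ℕ) :
    evalList ξ (addMul M c l m) = c * evalList ξ l + evalList ξ m := by
  induction l generalizing m with
  | nil => simp [addMul]
  | cons x l ih =>
    cases m with
    | nil => simp [addMul, force_eq, ih, natCast_mod_of_eq_zero hM]; ring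
    | cons y m => simp [addMul, force_eq, ih, natCast_mod_of_eq_zero hM]; ring

theorem evalList_map_mul (ξ : R) (q : ℕ) (l : List ℕ) :
    evalList ξ (l.map (q * ·)) = q * evalList ξ l := by
  induction l with
  | nil => simp
  | cons c l ih => simp [ih]; ring

theorem evalList_map_sub {M : ℕ} (hM : (M : R) = 0) (ξ : R) {l : List ℕ} (hl : ∀ c ∈ l, c ≤ M) :
    evalList ξ (l.map (M - ·)) = - evalList ξ l := by
  induction l with
  | nil => simp
  | cons c l ih =>
    rw [List.map_cons, evalList_cons, evalList_cons, ih fun c hc => hl c (List.mem_cons_of_mem _ hc),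
      Nat.cast_sub (hl c List.mem_cons_self), hM]
    ring

end Semantics

section Modular
variable (p : ℕ) (e : List ℕ)

/-- Rewriting `ξ ^ d` as `e(ξ)` in a polynomial of degree `d = e.length`. -/
def reduceTop (l : List ℕ) : List ℕ :=
  match l.drop e.length with
  | [t] => addMul p t e (l.take e.length)
  | _ => l

/-- The remainder of a polynomial on division by `ξ ^ d - e(ξ)`. -/
def reduceList (l : List ℕ) : List ℕ := l.foldr (fun c acc => reduceTop p e (c :: acc)) []

/-- Multiplication modulo `ξ ^ d - e(ξ)`. -/
def mulList (l m : List ℕ) : List ℕ :=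
  l.foldr (fun c acc => addMul p c m (reduceTop p e (0 :: acc))) []

/-- Powers modulo `ξ ^ d - e(ξ)`. -/
def powList (l : List ℕ) : ℕ → List ℕ
  | 0 => [1]
  | k + 1 => forceList (powList l k) fun m => mulList p e m l

variable {p e} {R : Type*} [CommRing R]

theorem evalList_reduceTop (hp : (p : R) = 0) {ξ : R}
    (he : ξ ^ e.length = evalList ξ e) (l : List ℕ) : evalList ξ (reduceTop p e l) = evalList ξ l := by
  rw [reduceTop]
  split
  · next t ht =>
    conv_rhs => rw [← List.take_append_drop e.length l, evalList_append, ht]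
    have hlen : (l.take e.length).length = e.length := by
      have := congrArg List.length ht
      rw [List.length_drop, List.length_singleton] at this
      rw [List.length_take]
      omega
    rw [evalList_addMul hp, hlen, he]
    simp
    ring
  · rfl

theorem evalList_reduceList (hp : (p : R) = 0) {ξ : R}
    (he : ξ ^ e.length = evalList ξ e) (l : List ℕ) : evalList ξ (reduceList p e l) = evalList ξ l := by
  induction l with
  | nil => rfl
  | cons c l ih =>
    change evalList ξ (reduceTop p e (c :: reduceList p e l)) = _
    rw [evalList_reduceTop hp he, evalList_cons, ih, evalList_cons]

theorem evalList_mulList (hp : (p : R) = 0) {ξ : R}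
    (he : ξ ^ e.length = evalList ξ e) (l m : List ℕ) :
    evalList ξ (mulList p e l m) = evalList ξ l * evalList ξ m := by
  induction l with
  | nil => simp [mulList]
  | cons c l ih =>
    change evalList ξ (addMul p c m (reduceTop p e (0 :: mulList p e l m))) = _
    rw [evalList_addMul hp, evalList_reduceTop hp he, evalList_cons, ih, evalList_cons]
    push_cast
    ring

theorem evalList_powList (hp : (p : R) = 0) {ξ : R}
    (he : ξ ^ e.length = evalList ξ e) (l : List ℕ) (k : ℕ) :
    evalList ξ (powList p e l k) = evalList ξ l ^ k := by
  induction k with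
  | zero => simp [powList]
  | succ k ih => rw [powList, forceList_eq, evalList_mulList hp he, ih, pow_succ]

end Modular

open Polynomial in
-- In the quotient of `(ZMod p)[X]` by the monic polynomial `D` with lower coefficients `dl`, the
-- class of `X` satisfies `ξ^d = e(ξ)` with `e = -dl`. There the list operations compute true
-- products, and the list on the right is the constant `c`.
theorem dvd_pow_sub_of_powList {p : ℕ} {dl l : List ℕ} {k c : ℕ} (hdl : ∀ a ∈ dl, a ≤ p)
    (h : powList p (dl.map (p - ·)) (reduceList p (dl.map (p - ·)) l) k =
      c :: List.replicate (dl.length - 1) 0) :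
    evalList (X : (ZMod p)[X]) (dl ++ [1]) ∣ evalList X l ^ k - (c : (ZMod p)[X]) := by
  set D := evalList (X : (ZMod p)[X]) (dl ++ [1])
  let π := Ideal.Quotient.mk (Ideal.span {D})
  have hp : (p : (ZMod p)[X] ⧸ Ideal.span {D}) = 0 := by
    have h0 : ((p : ℕ) : (ZMod p)[X]) = 0 := by
      rw [← map_natCast (C : ZMod p →+* _), ZMod.natCast_self, map_zero]
    rw [← map_natCast π, h0, map_zero]
  have he : π X ^ (dl.map (p - ·)).length = evalList (π X) (dl.map (p - ·)) := by
    have h1 : π D = 0 := Ideal.Quotient.eq_zero_iff_mem.2 (Ideal.mem_span_singleton_self D)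
    rw [map_evalList, evalList_append] at h1
    rw [evalList_map_sub hp _ hdl, List.length_map]
    simp only [evalList_cons, evalList_nil] at h1
    push_cast at h1
    linear_combination h1
  have h2 := congrArg (evalList (π X)) h
  rw [evalList_powList hp he, evalList_reduceList hp he, evalList_cons,
    ← List.append_nil (List.replicate _ 0), evalList_replicate_append] at h2
  rw [← Ideal.mem_span_singleton, ← Ideal.Quotient.eq_zero_iff_mem, map_sub, map_pow]
  change π _ ^ k - π _ = 0
  rw [map_evalList, h2, map_natCast]
  simp

section Recurrence
open Polynomial

/-- The polynomials `n! y_n` in one variable for the coefficients `y_n` of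
`(1 + 3 h₂ t² + t³ + 3 h₄ t⁴) ^ (-1/3)`. -/
noncomputable def recPoly (h2 h4 : ℤ[X]) : ℕ → ℤ[X]
  | 0 => 1
  -- The recurrence for `y_(m+1)` multiplied by `m!`. Whenever an index `m - 1`, `m - 2` or `m - 3`
  -- is truncated, the factors `m`, `m - 1`, `m - 2` make the term vanish.
  | m + 1 => -((m * (3 * m - 1) : ℤ[X]) * h2 * recPoly h2 h4 (m - 1)
      + (m * (m - 1) ^ 2 : ℤ[X]) * recPoly h2 h4 (m - 2)
      + (m * (m - 1) * (m - 2) * (3 * m - 5) : ℤ[X]) * h4 * recPoly h2 h4 (m - 3))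
  decreasing_by all_goals omega

/-- One step of the computation of `recPoly (a₂ X ^ i₂) (a₄ X ^ i₄)` modulo `M`; the state
consists of the last four polynomials. -/
def recStep (M a2 i2 a4 i4 m : ℕ) :
    List ℕ × List ℕ × List ℕ × List ℕ → List ℕ × List ℕ × List ℕ × List ℕ
  | (a, b, c, d) =>
    force (M - a2 * (m * (3 * m + (M - 1))) % M) fun c2 =>
    force (M - m * (m - 1) ^ 2 % M) fun c3 =>
    force (M - a4 * (m * (m - 1) * (m - 2) * (3 * m + (M - 5))) % M) fun c4 =>
    forceList (addMul M c2 (List.replicate i2 0 ++ b)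
      (addMul M c3 c (addMul M c4 (List.replicate i4 0 ++ d) []))) fun r => (r, a, b, c)

/-- The coefficients of the polynomials `recPoly (a₂ X ^ i₂) (a₄ X ^ i₄)` modulo `M`. -/
def recList (M a2 i2 a4 i4 : ℕ) : ℕ → List ℕ × List ℕ × List ℕ × List ℕ
  | 0 => ([1], [], [], [])
  | m + 1 => recStep M a2 i2 a4 i4 m (recList M a2 i2 a4 i4 m)

/-- Negative coefficients are represented as `M - k % M`, and `3m - 1`, `3m - 5` as `3m + (M - 1)`,
`3m + (M - 5)`; hence `5 ≤ M`. -/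
theorem recList_spec {M : ℕ} (hM : 5 ≤ M) (a2 i2 a4 i4 n : ℕ) :
    let P := fun k => ((recPoly ((a2 : ℤ[X]) * X ^ i2) ((a4 : ℤ[X]) * X ^ i4) k).map (Int.castRingHom (ZMod M)))
    let L := recList M a2 i2 a4 i4 n
    evalList X L.1 = P n ∧ (1 ≤ n → evalList X L.2.1 = P (n - 1)) ∧
      (2 ≤ n → evalList X L.2.2.1 = P (n - 2)) ∧ (3 ≤ n → evalList X L.2.2.2 = P (n - 3)) := by
  intro P
  have hM0 : (M : (ZMod M)[X]) = 0 := by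
    rw [← map_natCast (C : ZMod M →+* _), ZMod.natCast_self, map_zero]
  have hsub (k : ℕ) : ((M - k % M : ℕ) : (ZMod M)[X]) = -k := by
    rw [Nat.cast_sub (Nat.mod_lt _ (by omega)).le, natCast_mod_of_eq_zero hM0, hM0, zero_sub]
  have hsub' (k : ℕ) (hk : k ≤ 5) : ((M - k : ℕ) : (ZMod M)[X]) = -k := by
    rw [Nat.cast_sub (by omega), hM0, zero_sub]
  induction n with
  | zero => simp [recList, P, recPoly]
  | succ m ih =>
    dsimp only at ih ⊢
    rw [recList]
    generalize recList M a2 i2 a4 i4 m = L at ih ⊢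
    obtain ⟨a, b, c, d⟩ := L
    obtain ⟨h0, h1, h2, h3⟩ := ih
    dsimp only at h0 h1 h2 h3
    simp only [recStep, force_eq, forceList_eq]
    refine ⟨?_, fun _ => h0, fun h => ?_, fun h => ?_⟩
    · rw [evalList_addMul hM0, evalList_addMul hM0, evalList_addMul hM0, evalList_replicate_append,
        evalList_replicate_append, hsub, hsub, hsub, evalList_nil]
      push_cast
      rw [hsub' 1 (by omega), hsub' 5 (by omega)]
      simp only [P]
      rw [recPoly]
      simp only [Polynomial.map_neg, Polynomial.map_add, Polynomial.map_mul, Polynomial.map_sub,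
        Polynomial.map_natCast, Polynomial.map_ofNat, Polynomial.map_pow, Polynomial.map_one,
        Polynomial.map_X]
      rcases m with _ | _ | _ | m
      · simp
      · simp only [h1 (by omega), P]
        simp
        ring
      · simp only [h1 (by omega), h2 (by omega), P]
        simp
        ring
      · simp only [h1 (by omega), h2 (by omega), h3 (by omega), P]
        simp only [show m + 1 + 1 + 1 - 1 = m + 2 by omega,
          show m + 1 + 1 + 1 - 2 = m + 1 by omega, Nat.cast_add, Nat.cast_one, Nat.cast_ofNat]
        ring
    · rw [show m + 1 - 2 = m - 1 by omega]; exact h1 (by omega)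
    · rw [show m + 1 - 3 = m - 2 by omega]; exact h2 (by omega)

/-- If the computation modulo `q * p` yields `q * l`, then `recPoly` is `q * l` modulo `q * p`. -/
theorem exists_recPoly_eq {p q : ℕ} (hq : 5 ≤ q * p) {a2 i2 a4 i4 n : ℕ} {l : List ℕ}
    (h : (recList (q * p) a2 i2 a4 i4 n).1 = l.map (q * ·)) :
    ∃ E : ℤ[X], recPoly ((a2 : ℤ[X]) * X ^ i2) ((a4 : ℤ[X]) * X ^ i4) n = (q : ℤ[X]) * (evalList X l + (p : ℤ[X]) * E) := by
  have h1 := (recList_spec hq a2 i2 a4 i4 n).1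
  dsimp only at h1
  have h2 : (recPoly ((a2 : ℤ[X]) * X ^ i2) ((a4 : ℤ[X]) * X ^ i4) n - (q : ℤ[X]) * evalList X l).map
      (Int.castRingHom (ZMod (q * p))) = 0 := by
    rw [Polynomial.map_sub, ← h1, h, evalList_map_mul, Polynomial.map_mul, Polynomial.map_natCast,
      ← coe_mapRingHom, map_evalList, coe_mapRingHom, Polynomial.map_X, sub_self]
  have h3 : C ((q * p : ℕ) : ℤ) ∣ recPoly ((a2 : ℤ[X]) * X ^ i2) ((a4 : ℤ[X]) * X ^ i4) n - (q : ℤ[X]) * evalList X l := by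
    rw [C_dvd_iff_dvd_coeff]
    intro i
    have := congrArg (fun f => coeff f i) h2
    simp only [coeff_map, coeff_zero, eq_intCast] at this
    rwa [ZMod.intCast_zmod_eq_zero_iff_dvd] at this
  obtain ⟨E, hE⟩ := h3
  refine ⟨E, ?_⟩
  rw [sub_eq_iff_eq_add'.1 hE, map_natCast]
  push_cast
  ring

end Recurrence

end CoefficientLists

section
open Finset Polynomial

/-! ### Weighted homogenization -/

section HomogeneousEvaluation
variable {A B : Type*} [CommRing A] [CommRing B]

/-- The value at `x, z` of the polynomial in two variables of degree `n` that is obtained from `f`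
by homogenization, where `x` has degree `w` and `z` has degree `3`. -/
noncomputable def homEval (w : ℕ) (x z : A) (n : ℕ) : ℤ[X] →ₗ[ℤ] A :=
  Polynomial.lsum fun a => LinearMap.toSpanSingleton ℤ A (x ^ a * z ^ ((n - w * a) / 3))

theorem homEval_monomial (w : ℕ) (x z : A) (n a : ℕ) (c : ℤ) :
    homEval w x z n (monomial a c) = c * (x ^ a * z ^ ((n - w * a) / 3)) := by
  rw [homEval, Polynomial.lsum_apply, sum_monomial_index _ _ (by simp)]
  simp

theorem homEval_natCast_mul (w : ℕ) (x z : A) (n c : ℕ) (f : ℤ[X]) :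
    homEval w x z n ((c : ℤ[X]) * f) = c * homEval w x z n f := by
  rw [← nsmul_eq_mul, map_nsmul, nsmul_eq_mul]

theorem homEval_intCast_mul (w : ℕ) (x z : A) (n : ℕ) (c : ℤ) (f : ℤ[X]) :
    homEval w x z n ((c : ℤ[X]) * f) = c * homEval w x z n f := by
  rw [← zsmul_eq_mul, map_zsmul, zsmul_eq_mul]

theorem homEval_X_pow_mul (w : ℕ) (x z : A) (n i : ℕ) (f : ℤ[X]) :
    homEval w x z n (X ^ i * f) = x ^ i * homEval w x z (n - w * i) f := by
  induction f using Polynomial.induction_on' with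
  | add f g hf hg => rw [mul_add, map_add, hf, hg, map_add, mul_add]
  | monomial a c =>
    rw [X_pow_mul_monomial, homEval_monomial, homEval_monomial,
      show n - w * (a + i) = n - w * i - w * a by rw [mul_add]; omega]
    ring

theorem map_homEval (φ : A →+* B) (w : ℕ) (x z : A) (n : ℕ) (f : ℤ[X]) :
    φ (homEval w x z n f) = homEval w (φ x) (φ z) n f := by
  induction f using Polynomial.induction_on' with
  | add f g hf hg => rw [map_add, map_add, hf, hg, map_add]
  | monomial a c => simp [homEval_monomial]

/-- The polynomials in which all monomials have weight at most `n`. -/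
def weightLE (w n : ℕ) : Submodule ℤ ℤ[X] where
  carrier := {f | ∀ a, f.coeff a ≠ 0 → w * a ≤ n}
  add_mem' {f g} hf hg a h := by
    by_contra hlt
    exact h (by rw [coeff_add, of_not_not (mt (hf a) hlt), of_not_not (mt (hg a) hlt), add_zero])
  zero_mem' a h := absurd (coeff_zero a) h
  smul_mem' c f hf a h := hf a fun h0 => h (by rw [coeff_smul, h0, smul_zero])

theorem mem_weightLE {w n : ℕ} {f : ℤ[X]} (hf : w * f.natDegree ≤ n) : f ∈ weightLE w n :=
  fun _ h => (Nat.mul_le_mul_left w (le_natDegree_of_ne_zero h)).trans hf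

theorem natDegree_le_of_mem_weightLE {w n : ℕ} {f : ℤ[X]} (hf : f ∈ weightLE w n) :
    w * f.natDegree ≤ n := by
  by_cases h : f = 0
  · simp [h]
  · exact hf _ (by simpa using h)

theorem X_pow_mul_mem_weightLE {w n m i : ℕ} {f : ℤ[X]} (hf : f ∈ weightLE w m)
    (h : w * i + m ≤ n) : X ^ i * f ∈ weightLE w n := by
  intro a ha
  rw [coeff_X_pow_mul'] at ha
  split_ifs at ha with hi
  · have := hf _ ha
    obtain ⟨b, rfl⟩ := Nat.exists_eq_add_of_le hi
    rw [Nat.add_sub_cancel_left] at this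
    rw [mul_add]
    omega
  · exact absurd rfl ha

theorem weightLE_mono {w n m : ℕ} (h : n ≤ m) : weightLE w n ≤ weightLE w m :=
  fun _ hf a ha => (hf a ha).trans h

theorem intCast_mul_mem_weightLE {w n : ℕ} {f : ℤ[X]} (c : ℤ) (hf : f ∈ weightLE w n) :
    (c : ℤ[X]) * f ∈ weightLE w n := by
  rw [← zsmul_eq_mul]
  exact Submodule.smul_mem _ _ hf

theorem homEval_add_three {w : ℕ} (x z : A) {n : ℕ} {f : ℤ[X]} (hf : f ∈ weightLE w n) :
    homEval w x z (n + 3) f = z * homEval w x z n f := by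
  rw [f.as_sum_support, map_sum, map_sum, mul_sum]
  refine sum_congr rfl fun a ha => ?_
  have := hf a (mem_support_iff.1 ha)
  rw [homEval_monomial, homEval_monomial,
    show (n + 3 - w * a) / 3 = (n - w * a) / 3 + 1 by omega]
  ring

/-- All monomials have a weight which is at most `n` and congruent to `n` modulo `3`. -/
def IsHomogWeight (w n : ℕ) (f : ℤ[X]) : Prop := ∀ a, f.coeff a ≠ 0 → w * a ≤ n ∧ 3 ∣ n - w * a

/-- The exponent of `z` is a rounded quotient, so multiplicativity can fail in general. It suffices
that one factor is exactly homogeneous, since then rounding affects the other alone. -/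
theorem homEval_mul {w : ℕ} (x z : A) {n m : ℕ} {f g : ℤ[X]} (hf : IsHomogWeight w n f)
    (hg : g ∈ weightLE w m) :
    homEval w x z (n + m) (f * g) = homEval w x z n f * homEval w x z m g := by
  conv_lhs => rw [f.as_sum_support, g.as_sum_support, sum_mul_sum]
  conv_rhs => rw [f.as_sum_support, g.as_sum_support, map_sum, map_sum, sum_mul_sum]
  simp only [map_sum]
  refine sum_congr rfl fun a ha => sum_congr rfl fun b hb => ?_
  obtain ⟨h1, h2⟩ := hf a (mem_support_iff.1 ha)
  have h3 := hg b (mem_support_iff.1 hb)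
  rw [monomial_mul_monomial, homEval_monomial, homEval_monomial, homEval_monomial,
    show (n + m - w * (a + b)) / 3 = (n - w * a) / 3 + (m - w * b) / 3 by rw [mul_add]; omega]
  push_cast
  ring

theorem homEval_pow {w : ℕ} (x z : A) {n : ℕ} {f : ℤ[X]} (hf : IsHomogWeight w n f) (k : ℕ) :
    f ^ k ∈ weightLE w (k * n) ∧ homEval w x z (k * n) (f ^ k) = homEval w x z n f ^ k := by
  have hw : w * f.natDegree ≤ n := natDegree_le_of_mem_weightLE fun a ha => (hf a ha).1
  have hdeg (k : ℕ) : f ^ k ∈ weightLE w (k * n) := by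
    refine mem_weightLE ((Nat.mul_le_mul_left w natDegree_pow_le).trans ?_)
    rw [mul_left_comm]
    exact Nat.mul_le_mul_left k hw
  refine ⟨hdeg k, ?_⟩
  induction k with
  | zero =>
    rw [pow_zero, pow_zero, zero_mul, ← monomial_zero_one, homEval_monomial]
    simp
  | succ k ih => rw [pow_succ', show (k + 1) * n = n + k * n by ring, homEval_mul x z hf (hdeg k), ih, pow_succ']

/-- A congruence in one variable gives a relation between homogeneous values. -/
theorem homEval_pow_eq {p w d n k c : ℕ} {x z : A} (hp : (p : A) = 0) {D V : ℤ[X]} (hD : D.Monic)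
    (hDw : IsHomogWeight w d D) (hDd : w * D.natDegree = d) (hD0 : homEval w x z d D = 0)
    (hV : IsHomogWeight w n V) (hd : d ≤ k * n)
    (hdvd : D.map (Int.castRingHom (ZMod p)) ∣
      V.map (Int.castRingHom (ZMod p)) ^ k - (c : (ZMod p)[X])) :
    homEval w x z n V ^ k = c * z ^ (k * n / 3) := by
  obtain ⟨hVk, hVe⟩ := homEval_pow x z hV k
  have hc : (c : ℤ[X]) ∈ weightLE w (k * n) := mem_weightLE (by simp)
  have hce : homEval w x z (k * n) (c : ℤ[X]) = c * z ^ (k * n / 3) := by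
    rw [← map_natCast (C : ℤ →+* ℤ[X]), ← monomial_zero_left, homEval_monomial]
    simp
  set f := V ^ k - (c : ℤ[X]) with hf
  -- The leading term of `D` carries its full weight `d`, so division by `D` lowers the weight bound
  -- by `d`.
  have hS : f /ₘ D ∈ weightLE w (k * n - d) := by
    refine mem_weightLE ?_
    rw [natDegree_divByMonic f hD, Nat.mul_sub, hDd]
    exact Nat.sub_le_sub_right (natDegree_le_of_mem_weightLE (Submodule.sub_mem _ hVk hc)) d
  -- Division is carried out over `ℤ`; divisibility modulo `p` says that the remainder is a multiple
  -- of `p`, which vanishes in `A`. The multiple of `D` vanishes by `hD0`.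
  have hr : (f %ₘ D).map (Int.castRingHom (ZMod p)) = 0 := by
    rw [map_modByMonic _ hD, modByMonic_eq_zero_iff_dvd (hD.map _)]
    simpa [hf] using hdvd
  obtain ⟨E, hE⟩ : C (p : ℤ) ∣ f %ₘ D := by
    rw [C_dvd_iff_dvd_coeff]
    intro i
    have := congrArg (fun f => coeff f i) hr
    simpa [coeff_map, ZMod.intCast_zmod_eq_zero_iff_dvd] using this
  have h := modByMonic_add_div f D
  have h1 := congrArg (homEval w x z (k * n)) h
  have h2 := homEval_mul x z hDw hS
  rw [Nat.add_sub_cancel' hd, hD0, zero_mul] at h2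
  rw [map_add, h2, hE, map_natCast, homEval_natCast_mul, hp, zero_mul, add_zero, hf, map_sub, hVe,
    hce, eq_comm, sub_eq_zero] at h1
  exact h1

end HomogeneousEvaluation

/-! ### Homogenized solutions of the recurrence -/

section RecurrenceEvaluation
variable {A : Type*} [CommRing A]

theorem recPoly_mem_weightLE {w a2 i2 a4 i4 : ℕ} (h2 : a2 = 0 ∨ w * i2 = 2) (h4 : w * i4 = 4)
    (n : ℕ) : recPoly ((a2 : ℤ[X]) * X ^ i2) ((a4 : ℤ[X]) * X ^ i4) n ∈ weightLE w n := by
  induction n using Nat.strong_induction_on with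
  | _ n ih =>
    obtain _ | m := n
    · rw [recPoly]; exact mem_weightLE (by simp)
    rw [recPoly]
    refine Submodule.neg_mem _ (Submodule.add_mem _ (Submodule.add_mem _ ?_ ?_) ?_)
    · obtain _ | m := m
      · simp
      obtain rfl | h2 := h2
      · simp
      have := intCast_mul_mem_weightLE (((m + 1 : ℕ) : ℤ) * (3 * ((m + 1 : ℕ) : ℤ) - 1) * a2)
        (X_pow_mul_mem_weightLE (n := m + 1 + 1) (i := i2) (ih (m + 1 - 1) (by omega)) (by omega))
      convert this using 1
      push_cast; ring
    · have := intCast_mul_mem_weightLE ((m : ℤ) * (m - 1) ^ 2)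
        (weightLE_mono (m := m + 1) (by omega) (ih (m - 2) (by omega)))
      convert this using 1
      push_cast; ring
    · obtain _ | _ | _ | m := m
      · simp
      · simp
      · simp
      have := intCast_mul_mem_weightLE (((m + 3 : ℕ) : ℤ) * ((m + 3 : ℕ) - 1) * ((m + 3 : ℕ) - 2)
        * (3 * ((m + 3 : ℕ) : ℤ) - 5) * a4)
        (X_pow_mul_mem_weightLE (n := m + 3 + 1) (i := i4) (ih (m + 3 - 3) (by omega)) (by omega))
      convert this using 1
      push_cast; ring

/-- The polynomials `recPoly` compute the solution of the recurrence. -/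
theorem factorial_mul_eq_homEval {w a2 i2 a4 i4 : ℕ} (h2 : a2 = 0 ∨ w * i2 = 2) (h4 : w * i4 = 4)
    {x z : A} {y : ℕ → A} (hy0 : y 0 = 1)
    (hy : ∀ m : ℕ, ((m : A) + 1) * y (m + 1)
      + (if 1 ≤ m then (3 * (m : A) - 1) * (a2 * x ^ i2) * y (m - 1) else 0)
      + (if 2 ≤ m then ((m : A) - 1) * z * y (m - 2) else 0)
      + (if 3 ≤ m then (3 * (m : A) - 5) * (a4 * x ^ i4) * y (m - 3) else 0) = 0) (n : ℕ) :
    (n.factorial : A) * y n =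
      homEval w x z n (recPoly ((a2 : ℤ[X]) * X ^ i2) ((a4 : ℤ[X]) * X ^ i4) n) := by
  induction n using Nat.strong_induction_on with
  | _ n ih =>
    obtain _ | m := n
    · rw [recPoly, ← monomial_zero_one, homEval_monomial]
      simp [hy0]
    rw [recPoly, map_neg, map_add, map_add]
    set P := recPoly ((a2 : ℤ[X]) * X ^ i2) ((a4 : ℤ[X]) * X ^ i4)
    have t2 : homEval w x z (m + 1) ((m * (3 * m - 1) : ℤ[X]) * ((a2 : ℤ[X]) * X ^ i2) * P (m - 1)) =
        m.factorial * (if 1 ≤ m then (3 * (m : A) - 1) * (a2 * x ^ i2) * y (m - 1) else 0) := by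
      obtain _ | m := m
      · simp
      rw [show (((m + 1 : ℕ) : ℤ[X]) * (3 * ((m + 1 : ℕ) : ℤ[X]) - 1)) * ((a2 : ℤ[X]) * X ^ i2) *
        P (m + 1 - 1) = ((((m + 1 : ℕ) : ℤ) * (3 * ((m + 1 : ℕ) : ℤ) - 1) * a2 : ℤ) : ℤ[X]) *
        (X ^ i2 * P m) by push_cast; ring, homEval_intCast_mul,
        homEval_X_pow_mul, if_pos (by omega), Nat.add_sub_cancel]
      obtain rfl | h2 := h2
      · simp
      rw [h2, show m + 1 + 1 - 2 = m by omega, ← ih m (by omega), Nat.factorial_succ]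
      push_cast; ring
    have t3 : homEval w x z (m + 1) ((m * (m - 1) ^ 2 : ℤ[X]) * P (m - 2)) =
        m.factorial * (if 2 ≤ m then ((m : A) - 1) * z * y (m - 2) else 0) := by
      obtain _ | _ | m := m
      · simp
      · simp
      rw [show (((m + 1 + 1 : ℕ) : ℤ[X]) * (((m + 1 + 1 : ℕ) : ℤ[X]) - 1) ^ 2) *
        P (m + 1 + 1 - 2) = ((((m + 1 + 1 : ℕ) : ℤ) * (((m + 1 + 1 : ℕ) : ℤ) - 1) ^ 2 : ℤ) : ℤ[X]) *
        P m by push_cast; rfl, homEval_intCast_mul,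
        homEval_add_three x z (recPoly_mem_weightLE h2 h4 m), if_pos (by omega),
        show m + 1 + 1 - 2 = m by omega, ← ih m (by omega), Nat.factorial_succ, Nat.factorial_succ]
      push_cast; ring
    have t4 : homEval w x z (m + 1)
        ((m * (m - 1) * (m - 2) * (3 * m - 5) : ℤ[X]) * ((a4 : ℤ[X]) * X ^ i4) * P (m - 3)) =
        m.factorial * (if 3 ≤ m then (3 * (m : A) - 5) * (a4 * x ^ i4) * y (m - 3) else 0) := by
      obtain _ | _ | _ | m := m
      · simp
      · simp
      · simp
      rw [show (((m + 1 + 1 + 1 : ℕ) : ℤ[X]) * (((m + 1 + 1 + 1 : ℕ) : ℤ[X]) - 1) *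
        (((m + 1 + 1 + 1 : ℕ) : ℤ[X]) - 2) * (3 * ((m + 1 + 1 + 1 : ℕ) : ℤ[X]) - 5)) *
        ((a4 : ℤ[X]) * X ^ i4) * P (m + 1 + 1 + 1 - 3) =
        ((((m + 3 : ℕ) : ℤ) * (m + 2 : ℕ) * (m + 1 : ℕ) * (3 * ((m + 3 : ℕ) : ℤ) - 5) * a4 : ℤ) :
          ℤ[X]) * (X ^ i4 * P m) by
          push_cast; ring, homEval_intCast_mul,
        homEval_X_pow_mul, if_pos (by omega), h4, show m + 1 + 1 + 1 - 3 = m by omega,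
        show m + 1 + 1 + 1 + 1 - 4 = m by omega, ← ih m (by omega), Nat.factorial_succ,
        Nat.factorial_succ, Nat.factorial_succ]
      push_cast; ring
    rw [t2, t3, t4, Nat.factorial_succ]
    push_cast
    linear_combination (m.factorial : A) * hy m

end RecurrenceEvaluation

end

section
open RingTheory.Sequence

/-! ### Regular sequences and a criterion for the height -/

section RegularSequences
variable {R S : Type*} [CommRing R] [CommRing S]

/-- The ideal generated by the first `n` terms of a sequence. -/
def initialIdeal (v : ℕ → R) (n : ℕ) : Ideal R := Ideal.span (Set.range fun i : Fin n => v i)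

theorem ofList_take_ofFn (v : ℕ → R) {i n : ℕ} (h : i ≤ n) :
    Ideal.ofList ((List.ofFn fun j : Fin n => v j).take i) = initialIdeal v i := by
  rw [Ideal.ofList, initialIdeal]
  congr 1
  ext r
  simp only [Set.mem_ofPred_eq, Set.mem_range, List.mem_take_iff_getElem, List.length_ofFn,
    List.getElem_ofFn]
  constructor
  · rintro ⟨j, hj, rfl⟩
    exact ⟨⟨j, by omega⟩, rfl⟩
  · rintro ⟨j, rfl⟩
    exact ⟨j, by omega, rfl⟩

theorem isSMulRegular_quotient_iff (I : Ideal R) (r : R) :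
    IsSMulRegular (R ⧸ I • (⊤ : Submodule R R)) r ↔ ∀ a, r * a ∈ I → a ∈ I := by
  rw [isSMulRegular_iff_right_eq_zero_of_smul]
  constructor
  · intro h a ha
    have := h (Submodule.Quotient.mk a) (by
      rw [← Submodule.Quotient.mk_smul, Submodule.Quotient.mk_eq_zero]
      simpa using ha)
    rw [Submodule.Quotient.mk_eq_zero] at this
    simpa using this
  · intro h a
    induction a using Submodule.Quotient.induction_on with
    | _ a =>
      intro ha
      rw [← Submodule.Quotient.mk_smul, Submodule.Quotient.mk_eq_zero] at ha
      rw [Submodule.Quotient.mk_eq_zero]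
      simpa using h a (by simpa using ha)

theorem isWeaklyRegular_ofFn_iff (v : ℕ → R) (n : ℕ) :
    IsWeaklyRegular R (List.ofFn fun i : Fin n => v i) ↔
      ∀ i < n, ∀ a, v i * a ∈ initialIdeal v i → a ∈ initialIdeal v i := by
  rw [isWeaklyRegular_iff_Fin]
  constructor
  · intro h i hi a ha
    have := h ⟨i, by simpa using hi⟩
    rw [isSMulRegular_quotient_iff, ofList_take_ofFn v hi.le] at this
    exact this a (by simpa using ha)
  · rintro h ⟨i, hi⟩
    rw [List.length_ofFn] at hi
    rw [isSMulRegular_quotient_iff, ofList_take_ofFn v hi.le]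
    intro a ha
    exact h i hi a (by simpa using ha)

theorem initialIdeal_mono (v : ℕ → R) {m n : ℕ} (h : m ≤ n) : initialIdeal v m ≤ initialIdeal v n := by
  refine Ideal.span_mono ?_
  rintro _ ⟨i, rfl⟩
  exact ⟨⟨i, by omega⟩, rfl⟩

theorem mem_initialIdeal (v : ℕ → R) {m n : ℕ} (h : m < n) : v m ∈ initialIdeal v n :=
  Ideal.subset_span ⟨⟨m, h⟩, rfl⟩

theorem initialIdeal_eq_top (v : ℕ → R) {n m : ℕ} (hnm : n < m)
    (h : IsUnit (Ideal.Quotient.mk (initialIdeal v n) (v n))) : initialIdeal v m = ⊤ := by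
  obtain ⟨u, hu⟩ := h.exists_left_inv
  obtain ⟨u, rfl⟩ := Ideal.Quotient.mk_surjective u
  rw [← map_mul, ← map_one (Ideal.Quotient.mk _), Ideal.Quotient.eq] at hu
  rw [Ideal.eq_top_iff_one]
  have h1 := initialIdeal_mono v hnm.le hu
  have h2 := Ideal.mul_mem_left _ u (mem_initialIdeal v hnm)
  simpa using sub_mem h2 h1

/-- At stage `n` a unit is regular, and afterwards the quotient is zero, so exactness needs checking
below the height only. -/
theorem regular_of_isUnit (v : ℕ → R) (n : ℕ)
    (hreg : ∀ i < n, ∀ a, v i * a ∈ initialIdeal v i → a ∈ initialIdeal v i)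
    (h : IsUnit (Ideal.Quotient.mk (initialIdeal v n) (v n))) (i : ℕ) (a : R)
    (ha : v i * a ∈ initialIdeal v i) : a ∈ initialIdeal v i := by
  obtain hi | rfl | hi := lt_trichotomy i n
  · exact hreg i hi a ha
  · rw [← Ideal.Quotient.eq_zero_iff_mem] at ha ⊢
    rwa [map_mul, h.mul_right_eq_zero] at ha
  · rw [initialIdeal_eq_top v hi h]
    trivial

theorem map_initialIdeal (f : R →+* S) (v : ℕ → R) (n : ℕ) :
    (initialIdeal v n).map f = initialIdeal (fun i => f (v i)) n := by
  rw [initialIdeal, Ideal.map_span, ← Set.range_comp]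
  rfl

theorem initialIdeal_le_ker (f : R →+* S) (v : ℕ → R) (n : ℕ) (h : ∀ i < n, f (v i) = 0) :
    initialIdeal v n ≤ RingHom.ker f := by
  refine Ideal.span_le.2 ?_
  rintro _ ⟨i, rfl⟩
  exact h i i.2

/-- A criterion for Landweber exactness of a localization. -/
theorem isLandweberExactOfHeight_of_localization {p : ℕ} [Fact p.Prime] {T : Type*} [CommRing T]
    [Nontrivial T] [Algebra R S] [Module.Flat R S] (f : BP p →+* R) (n : ℕ)
    (hreg : ∀ i < n, ∀ a, f (BP.v p i) * a ∈ initialIdeal (fun i => f (BP.v p i)) i →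
      a ∈ initialIdeal (fun i => f (BP.v p i)) i)
    (ε : S →+* T) (hε : ∀ i < n, ε (algebraMap R S (f (BP.v p i))) = 0)
    (hu : IsUnit (Ideal.Quotient.mk (initialIdeal (fun i => algebraMap R S (f (BP.v p i))) n)
      (algebraMap R S (f (BP.v p n))))) :
    IsLandweberExactOfHeight ((algebraMap R S).comp f) n := by
  have h1 := (isWeaklyRegular_ofFn_iff (fun i => f (BP.v p i)) n).2 hreg
  have h2 := h1.of_flat (S := S)
  rw [List.map_ofFn] at h2
  -- Regularity passes to `S` by flatness. Nontriviality of the quotient is witnessed by the point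
  -- `ε`, at which the first `n` elements vanish.
  have h3 := (isWeaklyRegular_ofFn_iff (fun i => algebraMap R S (f (BP.v p i))) n).1 h2
  refine ⟨fun m => ?_, fun h => ?_, hu⟩
  · exact (isWeaklyRegular_ofFn_iff (fun i => algebraMap R S (f (BP.v p i))) m).2
      fun i _ => regular_of_isUnit _ n h3 hu i
  · have h4 : initialIdeal (fun i => algebraMap R S (f (BP.v p i))) n ≤ RingHom.ker ε :=
      initialIdeal_le_ker ε _ n hε
    have h5 : (1 : S) ∈ RingHom.ker ε := h4 ((Ideal.eq_top_iff_one _).1 h)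
    rw [RingHom.mem_ker, map_one] at h5
    exact one_ne_zero h5

theorem isUnit_of_forall_field.{u} {R : Type u} [CommRing R] {x : R}
    (h : ∀ (k : Type u) [Field k] (π : R →+* k), π x ≠ 0) : IsUnit x := by
  by_contra hx
  obtain ⟨m, hm, hxm⟩ := exists_max_ideal_of_mem_nonunits hx
  exact @h (R ⧸ m) (Ideal.Quotient.field m) (Ideal.Quotient.mk m)
    (Ideal.Quotient.eq_zero_iff_mem.2 hxm)

end RegularSequences

end

section
open PowerSeries

/-! ### Homogeneous evaluation of coefficient lists -/

section HomogeneousLists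
variable {A B : Type*} [CommRing A] [CommRing B]

/-- The value of `homEval` on the polynomial with the given coefficients. -/
def homEvalList (w : ℕ) (x z : A) : ℕ → List ℕ → A
  | _, [] => 0
  | n, c :: l => c * z ^ (n / 3) + x * homEvalList w x z (n - w) l

theorem homEval_evalList (w : ℕ) (x z : A) (n : ℕ) (l : List ℕ) :
    homEval w x z n (evalList Polynomial.X l) = homEvalList w x z n l := by
  induction l generalizing n with
  | nil => simp [homEvalList]
  | cons c l ih =>
    have h := homEval_X_pow_mul w x z n 1 (evalList Polynomial.X l)
    rw [pow_one, pow_one, mul_one, ih] at h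
    rw [evalList_cons, map_add, h, homEvalList, ← map_natCast (Polynomial.C : ℤ →+* _),
      ← Polynomial.monomial_zero_left, homEval_monomial]
    simp

theorem map_homEvalList (f : A →+* B) (w : ℕ) (x z : A) (n : ℕ) (l : List ℕ) :
    f (homEvalList w x z n l) = homEvalList w (f x) (f z) n l := by
  rw [← homEval_evalList, map_homEval, homEval_evalList]

/-- Homogeneity reduces nonvanishing along a whole orbit of the scaling action to one constant. -/
theorem homEval_scale {w : ℕ} (t x z : A) {n : ℕ} {f : Polynomial ℤ} (hf : IsHomogWeight w n f) :
    homEval w (t ^ w * x) (t ^ 3 * z) n f = t ^ n * homEval w x z n f := by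
  rw [f.as_sum_support, map_sum, map_sum, Finset.mul_sum]
  refine Finset.sum_congr rfl fun a ha => ?_
  obtain ⟨h1, h2⟩ := hf a (Polynomial.mem_support_iff.1 ha)
  have h3 : t ^ n = t ^ (w * a) * t ^ (3 * ((n - w * a) / 3)) := by
    rw [← pow_add]; congr 1; omega
  rw [homEval_monomial, homEval_monomial, h3, mul_pow, mul_pow, ← pow_mul, ← pow_mul]
  ring

/-- A test for the monomials `ξ ^ i, ξ ^ (i + 1), …` with the given coefficients to be homogeneous
of degree `n`. -/
def homogList (w n : ℕ) : ℕ → List ℕ → Bool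
  | _, [] => true
  | i, c :: l => (c == 0 || (Nat.ble (w * i) n && (n - w * i) % 3 == 0)) && homogList w n (i + 1) l

theorem isHomogWeight_of_homogList {w n : ℕ} {l : List ℕ} (i : ℕ) (h : homogList w n i l = true) :
    IsHomogWeight w n (Polynomial.X ^ i * evalList Polynomial.X l) := by
  induction l generalizing i with
  | nil => intro a ha; simp at ha
  | cons c l ih =>
    rw [homogList, Bool.and_eq_true] at h
    intro a ha
    rw [evalList_cons, mul_add, ← mul_assoc, ← pow_succ, Polynomial.coeff_add] at ha
    by_cases h2 : (Polynomial.X ^ (i + 1) * evalList Polynomial.X l : Polynomial ℤ).coeff a = 0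
    · rw [h2, add_zero, mul_comm, ← Polynomial.C_eq_natCast, Polynomial.coeff_C_mul_X_pow] at ha
      split_ifs at ha with h3
      · subst h3
        have h4 : c ≠ 0 := by rintro rfl; simp at ha
        have h5 := h.1
        simp only [Bool.or_eq_true, beq_iff_eq, h4, false_or, Bool.and_eq_true, Nat.ble_eq] at h5
        exact ⟨h5.1, Nat.dvd_of_mod_eq_zero h5.2⟩
      · exact absurd rfl ha
    · exact ih (i + 1) h.2 a h2

theorem evalList_append_one_monic (dl : List ℕ) :
    (evalList (Polynomial.X : Polynomial ℤ) (dl ++ [1])).Monic ∧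
      (evalList (Polynomial.X : Polynomial ℤ) (dl ++ [1])).natDegree = dl.length := by
  have h (l : List ℕ) : (evalList (Polynomial.X : Polynomial ℤ) l).degree < l.length := by
    induction l with
    | nil => simp
    | cons c l ih =>
      rw [evalList_cons]
      refine (Polynomial.degree_add_le _ _).trans_lt (max_lt ?_ ?_)
      · rw [← Polynomial.C_eq_natCast]
        exact Polynomial.degree_C_le.trans_lt (by simp; positivity)
      · by_cases h0 : evalList (Polynomial.X : Polynomial ℤ) l = 0
        · simp [h0]
        rw [Polynomial.degree_eq_natDegree h0] at ih
        rw [Polynomial.degree_eq_natDegree (mul_ne_zero Polynomial.X_ne_zero h0),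
          Polynomial.natDegree_X_mul h0, List.length_cons]
        norm_cast at ih ⊢
        omega
  rw [evalList_append]
  simp only [evalList_cons, evalList_nil, mul_zero, add_zero, Nat.cast_one, mul_one]
  rw [add_comm]
  exact ⟨Polynomial.monic_X_pow_add (h dl),
    by rw [Polynomial.natDegree_add_eq_left_of_degree_lt (by simpa using h dl),
      Polynomial.natDegree_X_pow]⟩

/-- A test for the `n`-th polynomial in the recurrence to be divisible by `q`, with a homogeneous
quotient whose `k`-th power is `c` modulo `p` and a monic polynomial. -/
def recCheck (p q w a2 i2 a4 i4 n : ℕ) (dl : List ℕ) (k c : ℕ) : Bool :=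
  forceList (recList (q * p) a2 i2 a4 i4 n).1 fun L =>
  forceList (L.map (· / q)) fun l =>
    L == l.map (q * ·) && homogList w n 0 l &&
      powList p (dl.map (p - ·)) (reduceList p (dl.map (p - ·)) l) k ==
        c :: List.replicate (dl.length - 1) 0

theorem exists_of_recCheck {p q w a2 i2 a4 i4 n k c : ℕ} {dl : List ℕ} (hq : 5 ≤ q * p)
    (hdl : ∀ a ∈ dl, a ≤ p) (h : recCheck p q w a2 i2 a4 i4 n dl k c = true) :
    ∃ V E : Polynomial ℤ,
      recPoly ((a2 : Polynomial ℤ) * Polynomial.X ^ i2) ((a4 : Polynomial ℤ) * Polynomial.X ^ i4) n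
        = (q : Polynomial ℤ) * (V + (p : Polynomial ℤ) * E) ∧
      IsHomogWeight w n V ∧
      (evalList Polynomial.X (dl ++ [1])).map (Int.castRingHom (ZMod p)) ∣
        V.map (Int.castRingHom (ZMod p)) ^ k - (c : Polynomial (ZMod p)) := by
  rw [recCheck, forceList_eq, forceList_eq] at h
  generalize hl : ((recList (q * p) a2 i2 a4 i4 n).1).map (· / q) = l at h
  simp only [Bool.and_eq_true, beq_iff_eq] at h
  obtain ⟨⟨h1, h2⟩, h3⟩ := h
  obtain ⟨E, hE⟩ := exists_recPoly_eq hq h1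
  refine ⟨_, E, hE, ?_, ?_⟩
  · have := isHomogWeight_of_homogList 0 h2
    rwa [pow_zero, one_mul] at this
  · rw [← Polynomial.coe_mapRingHom, map_evalList, map_evalList, Polynomial.coe_mapRingHom,
      Polynomial.map_X]
    exact dvd_pow_sub_of_powList hdl h3

end HomogeneousLists

end

/-! ### The computations for `p = 7` and `p = 13` -/

section KernelChecks

/-- The lower coefficients of the monic polynomial that is `v₂` modulo `(7, v₁)`, up to a unit. -/
def relSeven : List ℕ := [0, 2, 0, 0]

/-- The lower coefficients of the monic polynomial that is `v₂` modulo `(13, v₁)`, up to a unit. -/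
def relThirteen : List ℕ :=
  [0, 5, 0, 0, 10, 0, 0, 7, 0, 0, 9, 0, 0, 3, 0, 0, 6, 0, 0, 9, 0, 0, 3, 0, 0, 9, 0, 0]

theorem recCheck_seven : recCheck 7 (7 ^ 20) 4 0 0 1 1 114 relSeven 6 1 = true := by
  decide +kernel

theorem recList_seven : (recList (7 ^ 3 * 7) 0 0 1 1 16).1 =
    ((relSeven ++ [1]).map (2 * ·)).map (7 ^ 3 * ·) := by
  decide +kernel

theorem recList_thirteen : (recList (13 ^ 5 * 13) 1 1 2 2 56).1 =
    ((relThirteen ++ [1]).map (1 * ·)).map (13 ^ 5 * ·) := by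
  decide +kernel

/-- Here `16 = (7² - 1)/3`; likewise `114`, `56` and `732` below are `(p³ - 1)/3` or `(p² - 1)/3`.
The power of `p` dividing `n! p^e` is split off, and the residue of the cofactor `u` is the unit
relating `v₂` or `v₃` to the computed polynomial. -/
theorem factorial_seven_second : ∃ u, Nat.factorial 16 * 7 = 7 ^ 3 * u ∧ u % 7 = 4 :=
  ⟨Nat.factorial 16 * 7 / 7 ^ 3, by decide +kernel⟩

theorem factorial_seven_third : ∃ u, Nat.factorial 114 * 7 ^ 2 = 7 ^ 20 * u ∧ u % 7 = 1 :=
  ⟨Nat.factorial 114 * 7 ^ 2 / 7 ^ 20, by decide +kernel⟩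

theorem factorial_thirteen_second : ∃ u, Nat.factorial 56 * 13 = 13 ^ 5 * u ∧ u % 13 = 4 :=
  ⟨Nat.factorial 56 * 13 / 13 ^ 5, by decide +kernel⟩

theorem factorial_thirteen_third : ∃ u, Nat.factorial 732 * 13 ^ 2 = 13 ^ 62 * u ∧ u % 13 = 5 :=
  ⟨Nat.factorial 732 * 13 ^ 2 / 13 ^ 62, by decide +kernel⟩

theorem recCheck_thirteen : recCheck 13 (13 ^ 62) 2 1 1 2 2 732 relThirteen 18 1 = true := by
  decide +kernel

end KernelChecks

/-! ### The generators `v₂` and `v₃` modulo `(p, v₁)` -/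

section PicardReduction
open PowerSeries
variable {p : ℕ} [hp : Fact p.Prime]

/-- A retraction of `ℤ_(p)[G₂, G₃, G₄]` modulo `v₁`, after which the Picard genus is
governed by the polynomials `recPoly (a₂ X ^ i₂) (a₄ X ^ i₄)`. -/
structure PicardReduction (φ : BP p →ₐ[ZLocal p] GRing (ZLocal p)) (w a2 i2 a4 i4 : ℕ) where
  /-- The variable of weight `w`. -/
  x : GRing (ZLocal p)
  /-- The retraction. -/
  s : GRing (ZLocal p) →+* GRing (ZLocal p)
  weight_two : a2 = 0 ∨ w * i2 = 2
  weight_four : w * i4 = 4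
  map_G2 : s (G2 _) = 3 * (a2 * x ^ i2)
  map_G3 : s (G3 _) = G3 _
  map_G4 : s (G4 _) = 3 * (a4 * x ^ i4)
  map_v : s (φ (BP.v p 1)) = 0
  sub_mem : ∀ f, f - s f ∈ Ideal.span {φ (BP.v p 1)}

theorem factorial_mul_map_coeff {A B : Type*} [CommRing A] [CommRing B] [IsDomain B] [CharZero B]
    {y : A⟦X⟧} {g2 g3 g4 : A} (hyf : y ^ 3 * quarticSeries g2 g3 g4 = 1)
    (hy0 : constantCoeff y = 1) (s : A →+* B) {w a2 i2 a4 i4 : ℕ} (h2 : a2 = 0 ∨ w * i2 = 2)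
    (h4 : w * i4 = 4) {x : B} (hs2 : s g2 = 3 * (a2 * x ^ i2)) (hs4 : s g4 = 3 * (a4 * x ^ i4))
    (n : ℕ) : (n.factorial : B) * s (coeff (3 * n) y) = homEval w x (s g3) n
      (recPoly ((a2 : Polynomial ℤ) * Polynomial.X ^ i2)
        ((a4 : Polynomial ℤ) * Polynomial.X ^ i4) n) := by
  refine factorial_mul_eq_homEval (y := fun n => s (coeff (3 * n) y)) h2 h4 (by simp [hy0])
    (fun m => ?_) n
  have h := congrArg s (quartic_recurrence hyf (3 * (m + 1)))
  -- In degree `3(m + 1)`, with `g₂` and `g₄` equal to `3` times `h₂` and `h₄`, the quartic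
  -- recurrence is `9` times the required one.
  have h9 : (9 : B) ≠ 0 := by norm_num
  refine mul_left_cancel₀ h9 ?_
  rw [mul_zero]
  refine Eq.trans ?_ (h.trans (map_zero s))
  simp only [map_add, map_mul, apply_ite s, map_zero, map_natCast, map_ofNat, hs2, hs4,
    show (6 ≤ 3 * (m + 1)) = (1 ≤ m) from propext (by omega),
    show (9 ≤ 3 * (m + 1)) = (2 ≤ m) from propext (by omega),
    show (12 ≤ 3 * (m + 1)) = (3 ≤ m) from propext (by omega)]
  rw [show 3 * (m + 1) - 6 = 3 * (m - 1) by omega, show 3 * (m + 1) - 9 = 3 * (m - 2) by omega,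
    show 3 * (m + 1) - 12 = 3 * (m - 3) by omega]
  obtain _ | _ | _ | m := m
  · norm_num
  · simp; ring
  · simp; ring
  · simp only [show 1 ≤ m + 1 + 1 + 1 by omega, show 2 ≤ m + 1 + 1 + 1 by omega,
      show 3 ≤ m + 1 + 1 + 1 by omega, if_true, show m + 1 + 1 + 1 - 1 = m + 2 by omega,
      show m + 1 + 1 + 1 - 2 = m + 1 by omega, show m + 1 + 1 + 1 - 3 = m by omega]
    push_cast
    ring

namespace PicardReduction
variable {φ : BP p →ₐ[ZLocal p] GRing (ZLocal p)} {w a2 i2 a4 i4 : ℕ}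
  (R : PicardReduction φ w a2 i2 a4 i4)

theorem map_s {B : Type*} [CommRing B] {π : GRing (ZLocal p) →+* B}
    (h1 : π (φ (BP.v p 1)) = 0) (f : GRing (ZLocal p)) : π (R.s f) = π f := by
  obtain ⟨g, hg⟩ := Ideal.mem_span_singleton.1 (R.sub_mem f)
  have := congrArg π hg
  rw [map_sub, map_mul, h1, zero_mul, sub_eq_zero] at this
  exact this.symm

/-- The factor `q`, a power of `p` in the applications, must be cancelled in characteristic zero,
before passing to the ring `B` where `p = 0`. -/
theorem mul_eq_homEval_of_pow_mul_eq (hp3 : ¬ p ∣ 3)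
    {n e q u : ℕ} {t : GRing (ZLocal p)} (hq : q ≠ 0) (hu : n.factorial * p ^ e = q * u)
    (ht : ∀ y : (GRing (ZLocal p))⟦X⟧, PowerSeries.map (toRat p) y = picardLogDeriv →
      constantCoeff y = 1 → R.s (coeff (3 * n) y) = (p : GRing (ZLocal p)) ^ e * R.s t)
    {V E : Polynomial ℤ}
    (hV : recPoly ((a2 : Polynomial ℤ) * Polynomial.X ^ i2)
      ((a4 : Polynomial ℤ) * Polynomial.X ^ i4) n
        = (q : Polynomial ℤ) * (V + (p : Polynomial ℤ) * E))
    {B : Type*} [CommRing B] {π : GRing (ZLocal p) →+* B} (hpB : (p : B) = 0)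
    (h1 : π (φ (BP.v p 1)) = 0) :
    (u : B) * π t = homEval w (π R.x) (π (G3 _)) n V := by
  obtain ⟨y, hy, hyf, hy0⟩ := exists_integral_picardLogDeriv hp3
  have h := factorial_mul_map_coeff hyf hy0 R.s R.weight_two R.weight_four R.map_G2 R.map_G4 n
  rw [ht y hy hy0, hV, homEval_natCast_mul, map_add, homEval_natCast_mul, ← mul_assoc,
    ← Nat.cast_pow, ← Nat.cast_mul, hu, Nat.cast_mul, mul_assoc] at h
  have h' := congrArg π (mul_left_cancel₀ (Nat.cast_ne_zero.2 hq) h)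
  rw [map_add, map_mul, map_mul, map_natCast, map_natCast, hpB, zero_mul, add_zero, map_homEval,
    R.map_s h1, R.map_G3] at h'
  exact h'

theorem mul_map_v_two (hφ : ∀ x : BP p, toRat p (φ x) = picardGenus (x : MURat)) (hp3 : ¬ p ∣ 3)
    {n q u : ℕ} (hn : 3 * n = p ^ 2 - 1) (hq : q ≠ 0) (hu : n.factorial * p = q * u)
    {V E : Polynomial ℤ}
    (hV : recPoly ((a2 : Polynomial ℤ) * Polynomial.X ^ i2)
      ((a4 : Polynomial ℤ) * Polynomial.X ^ i4) n
        = (q : Polynomial ℤ) * (V + (p : Polynomial ℤ) * E))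
    {B : Type*} [CommRing B] {π : GRing (ZLocal p) →+* B} (hpB : (p : B) = 0)
    (h1 : π (φ (BP.v p 1)) = 0) :
    (u : B) * π (φ (BP.v p 2)) = homEval w (π R.x) (π (G3 _)) n V := by
  refine R.mul_eq_homEval_of_pow_mul_eq hp3 (e := 1) hq (by rwa [pow_one])
    (fun y hy hy0 => ?_) hV hpB h1
  -- The coefficient of degree `p² - 1` is `p v₂` plus a multiple of `v₁^p`, which `s` kills.
  have h := hazewinkel_recursion hφ hy 1
  rw [Finset.sum_range_succ, Finset.sum_range_one] at h
  norm_num at h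
  rw [hn, h, map_add, map_mul, map_mul, map_mul, map_pow, R.map_v, zero_pow hp.out.ne_zero]
  simp [hy0]

theorem mul_map_v_three (hφ : ∀ x : BP p, toRat p (φ x) = picardGenus (x : MURat)) (hp3 : ¬ p ∣ 3)
    {n q u : ℕ} (hn : 3 * n = p ^ 3 - 1) (hq : q ≠ 0) (hu : n.factorial * p ^ 2 = q * u)
    {V E : Polynomial ℤ}
    (hV : recPoly ((a2 : Polynomial ℤ) * Polynomial.X ^ i2)
      ((a4 : Polynomial ℤ) * Polynomial.X ^ i4) n
        = (q : Polynomial ℤ) * (V + (p : Polynomial ℤ) * E))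
    {B : Type*} [CommRing B] {π : GRing (ZLocal p) →+* B} (hpB : (p : B) = 0)
    (h1 : π (φ (BP.v p 1)) = 0) :
    (u : B) * π (φ (BP.v p 3)) = homEval w (π R.x) (π (G3 _)) n V := by
  refine R.mul_eq_homEval_of_pow_mul_eq hp3 (e := 2) hq hu
    (fun y hy hy0 => ?_) hV hpB h1
  -- The coefficient of degree `p³ - 1` is `p² v₃` plus a term with `v₂^p` and one with `v₁^(p²)`.
  -- The former also carries the coefficient of degree `p - 1`, which is `v₁`, so `s` kills both.
  have h := hazewinkel_recursion hφ hy 2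
  have h' := hazewinkel_recursion hφ hy 0
  rw [Finset.sum_range_succ, Finset.sum_range_succ, Finset.sum_range_one] at h
  rw [Finset.sum_range_one] at h'
  norm_num [hy0] at h h'
  rw [hn, h, h']
  simp [R.map_v, hp.out.ne_zero, zero_pow]

end PicardReduction
end PicardReduction

/-! ### Criteria for heights three and two -/

section HeightCriteria
variable {p : ℕ} [hp : Fact p.Prime]

theorem mem_initialIdeal_one {R : Type*} [CommRing R] {v : ℕ → R} {a : R} :
    a ∈ initialIdeal v 1 ↔ v 0 ∣ a := by
  rw [← Ideal.mem_span_singleton, initialIdeal]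
  congr! 2
  ext r
  simp

theorem span_le_initialIdeal {R : Type*} [CommRing R] (v : ℕ → R) {m n : ℕ} (h : m < n) :
    Ideal.span {v m} ≤ initialIdeal v n :=
  (Ideal.span_singleton_le_iff_mem _).2 (mem_initialIdeal v h)

theorem regular_two_of_prime {R : Type*} [CommRing R] {v : ℕ → R} (h0 : Prime (v 0))
    (h1 : ¬ v 0 ∣ v 1) (h00 : ∀ a, v 0 * a = 0 → a = 0) (i : ℕ) (hi : i < 2) (a : R)
    (ha : v i * a ∈ initialIdeal v i) : a ∈ initialIdeal v i := by
  interval_cases i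
  · have h : initialIdeal v 0 = ⊥ := by simp [initialIdeal]
    rw [h, Ideal.mem_bot] at ha ⊢
    exact h00 a ha
  · rw [mem_initialIdeal_one] at ha ⊢
    exact (h0.dvd_or_dvd ha).resolve_left h1

/-- Applying `s` to a relation `v₂ a ∈ (p, v₁)` gives `p ∣ s(v₂) s(a)`, hence `p ∣ s(a)`. Since `a -
s(a)` is a multiple of `v₁`, it follows that `a ∈ (p, v₁)`. -/
theorem regular_three_of_retraction {R : Type*} [CommRing R] {v : ℕ → R} (h0 : Prime (v 0))
    (h1 : ¬ v 0 ∣ v 1) (h00 : ∀ a, v 0 * a = 0 → a = 0) (s : R →+* R) (hs0 : s (v 0) = v 0)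
    (hs1 : s (v 1) = 0) (hs : ∀ f, f - s f ∈ Ideal.span {v 1}) (h2 : ¬ v 0 ∣ s (v 2)) (i : ℕ)
    (hi : i < 3) (a : R) (ha : v i * a ∈ initialIdeal v i) : a ∈ initialIdeal v i := by
  obtain hi' | rfl : i < 2 ∨ i = 2 := by omega
  · exact regular_two_of_prime h0 h1 h00 i hi' a ha
  have h3 : (initialIdeal v 2).map s ≤ initialIdeal v 1 := by
    rw [map_initialIdeal, initialIdeal, Ideal.span_le]
    rintro _ ⟨j, rfl⟩
    obtain ⟨j, hj⟩ := j
    interval_cases j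
    · exact mem_initialIdeal_one.2 (by simp [hs0])
    · exact mem_initialIdeal_one.2 (by simp [hs1])
  have h4 := h3 (Ideal.mem_map_of_mem s ha)
  rw [mem_initialIdeal_one, map_mul] at h4
  have h5 := initialIdeal_mono v (m := 1) (n := 2) (by norm_num)
    (mem_initialIdeal_one.2 ((h0.dvd_or_dvd h4).resolve_left h2))
  simpa using add_mem (span_le_initialIdeal v (by norm_num) (hs a)) h5

theorem MvPolynomial.prime_natCast_zLocal {σ : Type*} : Prime (p : MvPolynomial σ (ZLocal p)) := by
  rw [← map_natCast (MvPolynomial.C (σ := σ)), MvPolynomial.prime_C_iff]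
  exact ZLocal.prime_natCast

variable {φ : BP p →ₐ[ZLocal p] GRing (ZLocal p)}

theorem map_v_zero {R : Type*} [Ring R] (f : BP p →+* R) : f (BP.v p 0) = p := by
  rw [BP.v, map_natCast]

theorem isLandweberExactOfHeight_three {w a2 i2 a4 i4 : ℕ}
    (R : PicardReduction φ w a2 i2 a4 i4) (h1 : ¬ (p : GRing (ZLocal p)) ∣ φ (BP.v p 1))
    (h2 : ¬ (p : GRing (ZLocal p)) ∣ R.s (φ (BP.v p 2))) (ε : GRing (ZLocal p) →+* ZMod p)
    (hε1 : ε (φ (BP.v p 1)) = 0) (hε2 : ε (φ (BP.v p 2)) = 0) (hε3 : ε (G3 _) = 1)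
    (hu : ∀ (B : Type) [CommRing B] (π : GRing (ZLocal p) →+* B), (p : B) = 0 →
      π (φ (BP.v p 1)) = 0 → π (φ (BP.v p 2)) = 0 → IsUnit (π (G3 _)) →
      IsUnit (π (φ (BP.v p 3)))) :
    IsLandweberExactOfHeight
      ((algebraMap (GRing (ZLocal p)) (GRingLoc (ZLocal p))).comp φ.toRingHom) 3 := by
  have hv0 : φ.toRingHom (BP.v p 0) = (p : GRing (ZLocal p)) := map_v_zero _
  have hlift : IsUnit (ε (G3 (ZLocal p))) := by rw [hε3]; exact isUnit_one
  have : Module.Flat (GRing (ZLocal p)) (GRingLoc (ZLocal p)) :=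
    IsLocalization.flat _ (Submonoid.powers (G3 (ZLocal p)))
  refine isLandweberExactOfHeight_of_localization φ.toRingHom 3
    (regular_three_of_retraction ?_ ?_ ?_ R.s ?_ R.map_v R.sub_mem ?_)
    (IsLocalization.Away.lift (G3 (ZLocal p)) hlift) ?_ ?_
  · rw [hv0]; exact MvPolynomial.prime_natCast_zLocal
  · rw [hv0]; exact h1
  · rw [hv0]
    exact fun a ha => (mul_eq_zero.1 ha).resolve_left MvPolynomial.prime_natCast_zLocal.ne_zero
  · rw [hv0, map_natCast]
  · rw [hv0]; exact h2
  · intro i hi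
    rw [IsLocalization.Away.lift_eq]
    interval_cases i
    · rw [hv0, map_natCast, CharP.cast_eq_zero]
    · exact hε1
    · exact hε2
  · have hm (i : ℕ) (hi : i < 3) := Ideal.Quotient.eq_zero_iff_mem.2 (mem_initialIdeal
      (fun i => algebraMap (GRing (ZLocal p)) (GRingLoc (ZLocal p)) (φ.toRingHom (BP.v p i))) hi)
    refine hu _ ((Ideal.Quotient.mk (initialIdeal (fun i =>
      algebraMap (GRing (ZLocal p)) (GRingLoc (ZLocal p)) (φ.toRingHom (BP.v p i))) 3)).comp
        (algebraMap _ _)) ?_ (hm 1 (by norm_num)) (hm 2 (by norm_num)) ?_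
    · have := hm 0 (by norm_num)
      rwa [hv0, map_natCast, map_natCast] at this
    · exact (IsLocalization.Away.algebraMap_isUnit (G3 (ZLocal p))).map (Ideal.Quotient.mk _)

/-- Invertibility of `v₂` modulo `(p, v₁)` is tested at all residue fields, which is why `hu`
concerns fields. -/
theorem isLandweberExactOfHeight_two
    (h1 : ¬ (p : KLRing (ZLocal p)) ∣ restriction _ (φ (BP.v p 1)))
    (ε : KLRing (ZLocal p) →+* ZMod p)
    (hε1 : ε (restriction _ (φ (BP.v p 1))) = 0) (hεu : IsUnit (ε (kap _ * lam _)))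
    (hu : ∀ (k : Type) [Field k] (π : KLRing (ZLocal p) →+* k), (p : k) = 0 →
      π (restriction _ (φ (BP.v p 1))) = 0 → π (kap _) ≠ 0 → π (lam _) ≠ 0 →
      π (restriction _ (φ (BP.v p 2))) ≠ 0) :
    IsLandweberExactOfHeight
      ((algebraMap (KLRing (ZLocal p)) (KLRingLoc (ZLocal p))).comp
        ((restriction (ZLocal p)).toRingHom.comp φ.toRingHom)) 2 := by
  set f := (restriction (ZLocal p)).toRingHom.comp φ.toRingHom with hf
  have hv0 : f (BP.v p 0) = (p : KLRing (ZLocal p)) := map_v_zero _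
  have : Module.Flat (KLRing (ZLocal p)) (KLRingLoc (ZLocal p)) :=
    IsLocalization.flat _ (Submonoid.powers (kap (ZLocal p) * lam (ZLocal p)))
  refine isLandweberExactOfHeight_of_localization f 2
    (regular_two_of_prime ?_ ?_ ?_)
    (IsLocalization.Away.lift (kap (ZLocal p) * lam (ZLocal p)) hεu) ?_ ?_
  · rw [hv0]; exact MvPolynomial.prime_natCast_zLocal
  · rw [hv0]; exact h1
  · rw [hv0]
    exact fun a ha => (mul_eq_zero.1 ha).resolve_left MvPolynomial.prime_natCast_zLocal.ne_zero
  · intro i hi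
    rw [IsLocalization.Away.lift_eq]
    interval_cases i
    · rw [hv0, map_natCast, CharP.cast_eq_zero]
    · exact hε1
  · refine isUnit_of_forall_field fun k _ π => ?_
    have hm (i : ℕ) (hi : i < 2) := congrArg π (Ideal.Quotient.eq_zero_iff_mem.2 (mem_initialIdeal
      (fun i => algebraMap (KLRing (ZLocal p)) (KLRingLoc (ZLocal p)) (f (BP.v p i))) hi))
    have hkl := ((IsLocalization.Away.algebraMap_isUnit (S := KLRingLoc (ZLocal p))
      (kap (ZLocal p) * lam (ZLocal p))).map (Ideal.Quotient.mk (initialIdeal (fun i =>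
        algebraMap (KLRing (ZLocal p)) (KLRingLoc (ZLocal p)) (f (BP.v p i))) 2))).map π
    rw [map_mul, map_mul, map_mul] at hkl
    have hkl' := mul_ne_zero_iff.1 hkl.ne_zero
    refine hu k (π.comp ((Ideal.Quotient.mk _).comp (algebraMap _ _))) ?_ ?_ hkl'.1 hkl'.2
    · have := hm 0 (by norm_num)
      rwa [hv0, map_natCast, map_natCast, map_natCast, map_zero] at this
    · exact (hm 1 (by norm_num)).trans (map_zero π)

end HeightCriteria

/-! ### The generator `v₁` and the elimination of a variable -/

section FirstGenerator
open PowerSeries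
variable {p : ℕ} [hp : Fact p.Prime] {φ : BP p →ₐ[ZLocal p] GRing (ZLocal p)}

theorem exists_coeff_eq_v_one (hφ : ∀ x : BP p, toRat p (φ x) = picardGenus (x : MURat))
    (hp3 : ¬ p ∣ 3) : ∃ y : (GRing (ZLocal p))⟦X⟧, coeff (p - 1) y = φ (BP.v p 1) ∧
      y ^ 3 * quarticSeries (G2 _) (G3 _) (G4 _) = 1 ∧ constantCoeff y = 1 := by
  obtain ⟨y, hy, hyf, hy0⟩ := exists_integral_picardLogDeriv hp3
  have h := hazewinkel_recursion hφ hy 0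
  rw [Finset.sum_range_one] at h
  norm_num [hy0] at h
  exact ⟨y, h, hyf, hy0⟩

theorem three_mul_v_one [Fact (Nat.Prime 7)] {φ : BP 7 →ₐ[ZLocal 7] GRing (ZLocal 7)}
    (hφ : ∀ x : BP 7, toRat 7 (φ x) = picardGenus (x : MURat)) :
    3 * φ (BP.v 7 1) = - G2 _ := by
  obtain ⟨y, hy1, hyf, hy0⟩ := exists_coeff_eq_v_one hφ (by norm_num)
  have h := quartic_recurrence hyf 6
  norm_num [hy0] at h hy1
  rw [hy1] at h
  refine mul_left_cancel₀ (show (6 : GRing (ZLocal 7)) ≠ 0 by norm_num) ?_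
  linear_combination h

theorem nine_mul_v_one [Fact (Nat.Prime 13)] {φ : BP 13 →ₐ[ZLocal 13] GRing (ZLocal 13)}
    (hφ : ∀ x : BP 13, toRat 13 (φ x) = picardGenus (x : MURat)) :
    9 * φ (BP.v 13 1) = 2 * G2 _ ^ 2 - 3 * G4 _ := by
  obtain ⟨y, hy1, hyf, hy0⟩ := exists_coeff_eq_v_one hφ (by norm_num)
  -- Degree `12` involves the coefficients of degree `6`, `3` and `0`, of which the one in degree
  -- `3` is zero.
  have h := quartic_recurrence hyf 12
  have h6 := quartic_recurrence hyf 6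
  have h3 := quartic_recurrence hyf 3
  norm_num [hy0] at h h6 h3 hy1
  rw [hy1, h3] at h
  refine mul_left_cancel₀ (show (12 : GRing (ZLocal 13)) ≠ 0 by norm_num) ?_
  linear_combination 3 * h - 4 * G2 _ * h6

theorem sub_mem_of_forall_X {R σ : Type*} [CommRing R] (s : MvPolynomial σ R →ₐ[R] MvPolynomial σ R)
    {I : Ideal (MvPolynomial σ R)} (h : ∀ i, MvPolynomial.X i - s (MvPolynomial.X i) ∈ I)
    (f : MvPolynomial σ R) : f - s f ∈ I := by
  have : Ideal.Quotient.mkₐ R I = (Ideal.Quotient.mkₐ R I).comp s := by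
    refine MvPolynomial.algHom_ext fun i => ?_
    exact Ideal.Quotient.eq.2 (h i)
  exact Ideal.Quotient.eq.1 (DFunLike.congr_fun this f)

theorem exists_reduction_seven [Fact (Nat.Prime 7)] {φ : BP 7 →ₐ[ZLocal 7] GRing (ZLocal 7)}
    (hφ : ∀ x : BP 7, toRat 7 (φ x) = picardGenus (x : MURat)) :
    ∃ R : PicardReduction φ 4 0 0 1 1, 3 * R.x = G4 _ := by
  obtain ⟨t, ht⟩ := (GRing.isUnit_natCast (p := 7) (n := 3) (by norm_num)).exists_right_inv
  push_cast at ht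
  have h := three_mul_v_one hφ
  let s : GRing (ZLocal 7) →ₐ[ZLocal 7] GRing (ZLocal 7) :=
    MvPolynomial.aeval ![0, G3 _, G4 _]
  have h2 : s (G2 _) = 0 := MvPolynomial.aeval_X _ _
  have h3 : s (G3 _) = G3 _ := MvPolynomial.aeval_X _ _
  have h4 : s (G4 _) = G4 _ := MvPolynomial.aeval_X _ _
  have hx : 3 * (t * G4 (ZLocal 7)) = G4 _ := by linear_combination G4 (ZLocal 7) * ht
  refine ⟨⟨t * G4 _, s, Or.inl rfl, rfl, ?_, h3, ?_, ?_, ?_⟩, hx⟩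
  · rw [RingHom.coe_coe, h2]; simp
  · rw [RingHom.coe_coe, h4]; simp [hx]
  · have := congrArg s h
    rw [map_mul, map_neg, h2, map_ofNat, neg_zero] at this
    exact (mul_eq_zero.1 this).resolve_left (by norm_num)
  · refine sub_mem_of_forall_X s fun i => ?_
    rw [Ideal.mem_span_singleton]
    fin_cases i
    · refine ⟨-3, ?_⟩
      change G2 _ - s (G2 _) = _
      rw [h2]; linear_combination h
    · change _ ∣ G3 _ - s (G3 _)
      rw [h3, sub_self]; exact dvd_zero _
    · change _ ∣ G4 _ - s (G4 _)
      rw [h4, sub_self]; exact dvd_zero _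

theorem exists_reduction_thirteen [Fact (Nat.Prime 13)]
    {φ : BP 13 →ₐ[ZLocal 13] GRing (ZLocal 13)}
    (hφ : ∀ x : BP 13, toRat 13 (φ x) = picardGenus (x : MURat)) :
    ∃ R : PicardReduction φ 2 1 1 2 2, 3 * R.x = G2 _ := by
  obtain ⟨t, ht⟩ := (GRing.isUnit_natCast (p := 13) (n := 3) (by norm_num)).exists_right_inv
  push_cast at ht
  have h := nine_mul_v_one hφ
  have hx : 3 * (t * G2 (ZLocal 13)) = G2 _ := by linear_combination G2 (ZLocal 13) * ht
  -- With `t = 1/3` and `x = t G₂`, the relation `3G₄ = 2G₂²` that `v₁ = 0` imposes reads `G₄ =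
  -- 6x²`.
  let s : GRing (ZLocal 13) →ₐ[ZLocal 13] GRing (ZLocal 13) :=
    MvPolynomial.aeval ![G2 _, G3 _, 6 * (t * G2 _) ^ 2]
  have h2 : s (G2 _) = G2 _ := MvPolynomial.aeval_X _ _
  have h3 : s (G3 _) = G3 _ := MvPolynomial.aeval_X _ _
  have h4 : s (G4 _) = 6 * (t * G2 _) ^ 2 := MvPolynomial.aeval_X _ _
  refine ⟨⟨t * G2 _, s, Or.inr rfl, rfl, ?_, h3, ?_, ?_, ?_⟩, hx⟩
  · rw [RingHom.coe_coe, h2]; simp [hx]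
  · rw [RingHom.coe_coe, h4]; push_cast; ring
  · have := congrArg s h
    rw [map_mul, map_sub, map_mul, map_mul, map_pow, h2, h4, map_ofNat, map_ofNat, map_ofNat] at this
    have h9 : 9 * s (φ (BP.v 13 1)) = 0 := by
      rw [this]
      linear_combination -2 * (G2 _ + 3 * (t * G2 (ZLocal 13))) * hx
    exact (mul_eq_zero.1 h9).resolve_left (by norm_num)
  · refine sub_mem_of_forall_X s fun i => ?_
    rw [Ideal.mem_span_singleton]
    fin_cases i
    · change _ ∣ G2 _ - s (G2 _)
      rw [h2, sub_self]; exact dvd_zero _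
    · change _ ∣ G3 _ - s (G3 _)
      rw [h3, sub_self]; exact dvd_zero _
    · refine ⟨-9 * t, ?_⟩
      change G4 _ - s (G4 _) = _
      rw [h4]
      linear_combination t * h - (G4 (ZLocal 13) + 2 * t * G2 _ ^ 2) * ht

end FirstGenerator

/-! ### The congruences modulo `(p, v₁, v₂)` -/

section Congruences

theorem natCast_eq_of_mod_eq {B : Type*} [CommRing B] {p u r : ℕ} (hpB : (p : B) = 0)
    (h : u % p = r) : (u : B) = r := by
  rw [← h, natCast_mod_of_eq_zero hpB]

theorem relSeven_homog :
    IsHomogWeight 4 16 (evalList Polynomial.X (relSeven ++ [1])) := by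
  simpa using isHomogWeight_of_homogList (w := 4) (n := 16) (l := relSeven ++ [1]) 0 (by decide)

section Seven
variable [Fact (Nat.Prime 7)] {φ : BP 7 →ₐ[ZLocal 7] GRing (ZLocal 7)}
  {B : Type*} [CommRing B] {π : GRing (ZLocal 7) →+* B}

theorem two_mul_map_v_two (hφ : ∀ x : BP 7, toRat 7 (φ x) = picardGenus (x : MURat))
    (R : PicardReduction φ 4 0 0 1 1) (hpB : (7 : B) = 0)
    (h1 : π (φ (BP.v 7 1)) = 0) : 2 * π (φ (BP.v 7 2)) =
      homEvalList 4 (π R.x) (π (G3 _)) 16 (relSeven ++ [1]) := by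
  obtain ⟨u, hu, hur⟩ := factorial_seven_second
  obtain ⟨E, hE⟩ := exists_recPoly_eq (by norm_num) recList_seven
  have h := R.mul_map_v_two hφ (by norm_num) (by norm_num) (by norm_num) hu hE
    (by exact_mod_cast hpB) h1
  rw [natCast_eq_of_mod_eq (by exact_mod_cast hpB) hur, evalList_map_mul, homEval_natCast_mul,
    homEval_evalList] at h
  push_cast at h
  linear_combination 4 * h
    + (homEvalList 4 (π R.x) (π (G3 _)) 16 (relSeven ++ [1]) - 2 * π (φ (BP.v 7 2))) * hpB

theorem map_v_three_pow_six (hφ : ∀ x : BP 7, toRat 7 (φ x) = picardGenus (x : MURat))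
    (R : PicardReduction φ 4 0 0 1 1) (hpB : (7 : B) = 0)
    (h1 : π (φ (BP.v 7 1)) = 0) (h2 : π (φ (BP.v 7 2)) = 0) :
    π (φ (BP.v 7 3)) ^ 6 = π (G3 _) ^ 228 := by
  have hpB' : ((7 : ℕ) : B) = 0 := by exact_mod_cast hpB
  have h := two_mul_map_v_two hφ R hpB h1
  rw [h2, mul_zero, ← homEval_evalList] at h
  obtain ⟨u, hu, hur⟩ := factorial_seven_third
  obtain ⟨V, E, hE, hV, hdvd⟩ := exists_of_recCheck (by norm_num) (by decide) recCheck_seven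
  have h3 := R.mul_map_v_three hφ (by norm_num) (by norm_num) (by norm_num) hu hE hpB' h1
  have h4 := homEval_pow_eq hpB' (evalList_append_one_monic relSeven).1 relSeven_homog
    (by rw [(evalList_append_one_monic relSeven).2]; rfl) h.symm hV (by norm_num) hdvd
  rw [← h3, natCast_eq_of_mod_eq hpB' hur] at h4
  simpa using h4

/-- With `G₂ = 0`, `G₄ = 3x` and `z = G₃`, one has `Δ_C ≡ z⁴ + 3x³` modulo `7`, while `v₂ = 0` reads
`x⁴ + 2xz⁴ = 0`. Already `Δ_C³ ≡ z¹²`, and `57 = 3 * 19`. -/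
theorem map_deltaC_pow (hφ : ∀ x : BP 7, toRat 7 (φ x) = picardGenus (x : MURat))
    (R : PicardReduction φ 4 0 0 1 1) (hR : 3 * R.x = G4 _) (hpB : (7 : B) = 0)
    (h1 : π (φ (BP.v 7 1)) = 0) (h2 : π (φ (BP.v 7 2)) = 0) :
    π (deltaC (ZLocal 7)) ^ 57 = π (G3 _) ^ 228 := by
  have h := two_mul_map_v_two hφ R hpB h1
  simp [h2, homEvalList, relSeven] at h
  have hG2 : π (G2 _) = 0 := by
    have := congrArg π (three_mul_v_one hφ)
    rwa [map_mul, h1, mul_zero, map_neg, eq_comm, neg_eq_zero] at this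
  have hG4 : π (G4 _) = 3 * π R.x := by rw [← hR, map_mul, map_ofNat]
  generalize π R.x = x at h hG4
  generalize hz : π (G3 (ZLocal 7)) = z at h
  have hΔ : π (deltaC (ZLocal 7)) = z ^ 4 + 3 * x ^ 3 := by
    simp only [deltaC, map_add, map_sub, map_mul, map_pow, map_ofNat, hG2, hG4, hz]
    linear_combination (-4 * z ^ 4 + 987 * x ^ 3) * hpB
  have h3 : π (deltaC (ZLocal 7)) ^ 3 = z ^ 12 := by
    rw [hΔ]
    -- After elimination of `x⁴` the cube is `z¹² + (9 - 54 + 108) x³z⁸`, and the bracket is `9 *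
    -- 7`.
    linear_combination (-27 * x ^ 5 + 27 * x ^ 2 * z ^ 4) * h + 9 * z ^ 8 * x ^ 3 * hpB
  rw [show 57 = 3 * 19 by norm_num, pow_mul, h3]
  ring

end Seven
theorem relThirteen_homog :
    IsHomogWeight 2 56 (evalList Polynomial.X (relThirteen ++ [1])) := by
  simpa using isHomogWeight_of_homogList (w := 2) (n := 56) (l := relThirteen ++ [1]) 0 (by decide)

section Thirteen
variable [Fact (Nat.Prime 13)] {φ : BP 13 →ₐ[ZLocal 13] GRing (ZLocal 13)}
  {B : Type*} [CommRing B] {π : GRing (ZLocal 13) →+* B}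

theorem four_mul_map_v_two (hφ : ∀ x : BP 13, toRat 13 (φ x) = picardGenus (x : MURat))
    (R : PicardReduction φ 2 1 1 2 2) (hpB : (13 : B) = 0)
    (h1 : π (φ (BP.v 13 1)) = 0) : 4 * π (φ (BP.v 13 2)) =
      homEvalList 2 (π R.x) (π (G3 _)) 56 (relThirteen ++ [1]) := by
  obtain ⟨u, hu, hur⟩ := factorial_thirteen_second
  obtain ⟨E, hE⟩ := exists_recPoly_eq (by norm_num) recList_thirteen
  have h := R.mul_map_v_two hφ (by norm_num) (by norm_num) (by norm_num) hu hE
    (by exact_mod_cast hpB) h1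
  rw [natCast_eq_of_mod_eq (by exact_mod_cast hpB) hur, evalList_map_mul, homEval_natCast_mul,
    homEval_evalList, Nat.cast_one, one_mul] at h
  exact_mod_cast h

theorem map_v_three_pow_eighteen (hφ : ∀ x : BP 13, toRat 13 (φ x) = picardGenus (x : MURat))
    (R : PicardReduction φ 2 1 1 2 2) (hpB : (13 : B) = 0)
    (h1 : π (φ (BP.v 13 1)) = 0) (h2 : π (φ (BP.v 13 2)) = 0) :
    π (φ (BP.v 13 3)) ^ 18 = - π (G3 _) ^ 4392 := by
  have hpB' : ((13 : ℕ) : B) = 0 := by exact_mod_cast hpB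
  have h := four_mul_map_v_two hφ R hpB h1
  rw [h2, mul_zero, ← homEval_evalList] at h
  obtain ⟨u, hu, hur⟩ := factorial_thirteen_third
  obtain ⟨V, E, hE, hV, hdvd⟩ := exists_of_recCheck (by norm_num) (by decide) recCheck_thirteen
  have h3 := R.mul_map_v_three hφ (by norm_num) (by norm_num) (by norm_num) hu hE hpB' h1
  have h4 := homEval_pow_eq hpB' (evalList_append_one_monic relThirteen).1 relThirteen_homog
    (by rw [(evalList_append_one_monic relThirteen).2]; rfl) h.symm hV (by norm_num) hdvd
  rw [← h3, natCast_eq_of_mod_eq hpB' hur, mul_pow] at h4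
  push_cast at h4
  -- The sign in the congruence comes from the unit `u ≡ 5` by which the computed polynomial differs
  -- from `v₃`.
  have h5 : (5 : B) ^ 18 = -1 := by
    linear_combination ((5 ^ 18 + 1) / 13 : ℕ) * hpB
  rw [h5] at h4
  linear_combination -h4

end Thirteen
end Congruences

/-! ### Points modulo `p` and the restriction map -/

section Evaluation
variable {p : ℕ} [hp : Fact p.Prime]

/-- The homomorphism to `ZMod p` with the given values at the generators. -/
noncomputable def evalGRing (a b c : ZMod p) : GRing (ZLocal p) →+* ZMod p :=
  MvPolynomial.eval₂Hom (ZLocal.toZMod p) ![a, b, c]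

@[simp] theorem evalGRing_G2 (a b c : ZMod p) : evalGRing a b c (G2 _) = a :=
  MvPolynomial.eval₂Hom_X' _ _ _
@[simp] theorem evalGRing_G3 (a b c : ZMod p) : evalGRing a b c (G3 _) = b :=
  MvPolynomial.eval₂Hom_X' _ _ _
@[simp] theorem evalGRing_G4 (a b c : ZMod p) : evalGRing a b c (G4 _) = c :=
  MvPolynomial.eval₂Hom_X' _ _ _

/-- The homomorphism to `ZMod p` with the given values at the generators. -/
noncomputable def evalKLRing (a b : ZMod p) : KLRing (ZLocal p) →+* ZMod p :=
  MvPolynomial.eval₂Hom (ZLocal.toZMod p) ![a, b]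

@[simp] theorem evalKLRing_kap (a b : ZMod p) : evalKLRing a b (kap _) = a :=
  MvPolynomial.eval₂Hom_X' _ _ _
@[simp] theorem evalKLRing_lam (a b : ZMod p) : evalKLRing a b (lam _) = b :=
  MvPolynomial.eval₂Hom_X' _ _ _

theorem not_natCast_dvd_of_map_ne_zero {R : Type*} [CommRing R] (f : R →+* ZMod p) {x : R}
    (hx : f x ≠ 0) : ¬ (p : R) ∣ x := by
  rintro ⟨y, rfl⟩
  simp at hx

/-- The definition with denominators cleared, so that later steps can be polynomial identities; `108
Δ₆ = λ - κ²` has been inserted. -/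
theorem restriction_generators (h2 : ¬ p ∣ 2) (h3 : ¬ p ∣ 3) :
    8 * restriction (ZLocal p) (G2 _) = -(2 * lam _ + kap _ ^ 2) ∧
    8 * restriction (ZLocal p) (G3 _) = kap _ * lam _ ∧
    256 * restriction (ZLocal p) (G4 _) = - kap _ ^ 2 * (4 * lam _ - kap _ ^ 2) := by
  have key (m n : ℕ) : (MvPolynomial.C (Ring.inverse ((2 ^ m * 3 ^ n : ℕ) : ZLocal p)) :
      KLRing (ZLocal p)) * ((2 ^ m * 3 ^ n : ℕ) : KLRing (ZLocal p)) = 1 := by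
    have hu : IsUnit ((2 ^ m * 3 ^ n : ℕ) : ZLocal p) := by
      refine ZLocal.isUnit_natCast fun h => ?_
      obtain h | h := (Nat.Prime.dvd_mul hp.out).1 h
      · exact h2 (hp.out.dvd_of_dvd_pow h)
      · exact h3 (hp.out.dvd_of_dvd_pow h)
    rw [← map_natCast (MvPolynomial.C (σ := Fin 2)), ← map_mul, Ring.inverse_mul_cancel _ hu, map_one]
  have k8 := key 3 0
  have k108 := key 2 3
  have k2 := key 1 0
  have k256 := key 8 0
  norm_num at k8 k108 k2 k256
  have e2 : restriction (ZLocal p) (G2 _) = _ := MvPolynomial.aeval_X _ _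
  have e3 : restriction (ZLocal p) (G3 _) = _ := MvPolynomial.aeval_X _ _
  have e4 : restriction (ZLocal p) (G4 _) = _ := MvPolynomial.aeval_X _ _
  simp only [Matrix.cons_val, delta6, map_mul, map_ofNat] at e2 e3 e4
  rw [e2, e3, e4]
  refine ⟨?_, ?_, ?_⟩
  · linear_combination -3 * lam _ * k8 + (lam _ - kap _ ^ 2) * k108
      + 108 * MvPolynomial.C (Ring.inverse 108) * (lam _ - kap _ ^ 2) * k2
  · linear_combination kap _ * lam _ * k8
  · linear_combination -(kap _ ^ 2 * (3 * lam _ + 108 * (MvPolynomial.C (Ring.inverse 108) *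
      (lam _ - kap _ ^ 2)))) * k256 - kap _ ^ 2 * (lam _ - kap _ ^ 2) * k108

theorem intCast_ne_zero_of_not_dvd {k : Type*} [CommRing k] [Nontrivial k] (hpk : (p : k) = 0)
    {m : ℤ} (hm : ¬ (p : ℤ) ∣ m) : (m : k) ≠ 0 := by
  intro h
  obtain ⟨a, b, hab⟩ := ((Nat.prime_iff_prime_int.1 hp.out).coprime_iff_not_dvd.2 hm)
  have := congrArg (Int.cast : ℤ → k) hab
  push_cast at this
  simp [hpk, h] at this

theorem homEvalList_scale_ne_zero {k : Type*} [CommRing k] [IsDomain k] (hpk : (p : k) = 0)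
    {w n : ℕ} {l : List ℕ} (hl : IsHomogWeight w n (evalList Polynomial.X l)) {t x z : k}
    (ht : t ≠ 0) (a b : ℤ) (hx : x = t ^ w * a) (hz : z = t ^ 3 * b)
    (h : ¬ (p : ℤ) ∣ homEvalList w a b n l) : homEvalList w x z n l ≠ 0 := by
  rw [hx, hz, ← homEval_evalList, homEval_scale _ _ _ hl, homEval_evalList]
  have := map_homEvalList (Int.castRingHom k) w a b n l
  rw [eq_intCast, eq_intCast, eq_intCast] at this
  rw [← this]
  exact mul_ne_zero (pow_ne_zero _ ht) (intCast_ne_zero_of_not_dvd hpk h)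

end Evaluation

/-! ### Heights three and two for `p = 7` -/

section Seven
variable [Fact (Nat.Prime 7)] {φ : BP 7 →ₐ[ZLocal 7] GRing (ZLocal 7)}

theorem height_three_seven (hφ : ∀ x : BP 7, toRat 7 (φ x) = picardGenus (x : MURat)) :
    IsLandweberExactOfHeight
      ((algebraMap (GRing (ZLocal 7)) (GRingLoc (ZLocal 7))).comp φ.toRingHom) 3 := by
  obtain ⟨R, hR⟩ := exists_reduction_seven hφ
  have h7 : ((7 : ℕ) : ZMod 7) = 0 := CharP.cast_eq_zero _ 7
  have h7' : (7 : ZMod 7) = 0 := by exact_mod_cast h7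
  have hev (a b c : ZMod 7) : 3 * evalGRing a b c (φ (BP.v 7 1)) = -a := by
    have := congrArg (evalGRing a b c) (three_mul_v_one hφ)
    rwa [map_mul, map_neg, map_ofNat, evalGRing_G2] at this
  have hex (a b c : ZMod 7) : 3 * evalGRing a b c R.x = c := by
    have := congrArg (evalGRing a b c) hR
    rwa [map_mul, map_ofNat, evalGRing_G4] at this
  have hε (b c : ZMod 7) : evalGRing 0 b c (φ (BP.v 7 1)) = 0 := by
    linear_combination 5 * hev 0 b c - 2 * evalGRing 0 b c (φ (BP.v 7 1)) * h7'
  -- The point `(1, 0, 0)` shows `7 ∤ v₁`, and `(0, 1, 3)`, where `x = z = 1`, shows `7 ∤ s(v₂)`. At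
  -- `(0, 1, 0)` both `v₁` and `v₂` vanish: as `3 ∤ 16`, every monomial of `v₂` contains `x`.
  refine isLandweberExactOfHeight_three R
    (not_natCast_dvd_of_map_ne_zero (evalGRing 1 0 0) fun h => ?_)
    (not_natCast_dvd_of_map_ne_zero (evalGRing 0 1 3) fun h => ?_) (evalGRing 0 1 0)
    (hε 1 0) ?_ (evalGRing_G3 _ _ _) fun B _ π hp h1 h2 hu => ?_
  · have := hev 1 0 0
    rw [h] at this
    exact one_ne_zero (α := ZMod 7) (by linear_combination this)
  · rw [R.map_s (hε 1 3)] at h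
    have h2 := two_mul_map_v_two hφ R h7' (hε 1 3)
    have hx : evalGRing 0 1 3 R.x = 1 := by
      linear_combination 5 * hex 0 1 3 + (2 - 2 * evalGRing 0 1 3 R.x) * h7'
    rw [h, hx, evalGRing_G3, mul_zero] at h2
    exact homEvalList_scale_ne_zero h7 relSeven_homog one_ne_zero 1 1 (by simp) (by simp)
      (by decide +kernel) h2.symm
  · have h2 := two_mul_map_v_two hφ R h7' (hε 1 0)
    have hx : evalGRing 0 1 0 R.x = 0 := by
      linear_combination 5 * hex 0 1 0 - 2 * evalGRing 0 1 0 R.x * h7'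
    simp [hx, homEvalList, relSeven, -mul_eq_zero] at h2
    linear_combination 4 * h2 - evalGRing 0 1 0 (φ (BP.v 7 2)) * h7'
  · have h := map_v_three_pow_six hφ R (by exact_mod_cast hp) h1 h2
    exact (isUnit_pow_iff (by norm_num)).1 (h ▸ hu.pow 228)

theorem height_two_seven (hφ : ∀ x : BP 7, toRat 7 (φ x) = picardGenus (x : MURat)) :
    IsLandweberExactOfHeight
      ((algebraMap (KLRing (ZLocal 7)) (KLRingLoc (ZLocal 7))).comp
        ((restriction (ZLocal 7)).toRingHom.comp φ.toRingHom)) 2 := by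
  obtain ⟨R, hR⟩ := exists_reduction_seven hφ
  obtain ⟨r2, r3, r4⟩ := restriction_generators (p := 7) (by norm_num) (by norm_num)
  have hv := congrArg (restriction (ZLocal 7)) (three_mul_v_one hφ)
  rw [map_mul, map_neg, map_ofNat] at hv
  have h7 : ((7 : ℕ) : ZMod 7) = 0 := CharP.cast_eq_zero _ 7
  have h7' : (7 : ZMod 7) = 0 := by exact_mod_cast h7
  have hev (a b : ZMod 7) :
      24 * evalKLRing a b (restriction _ (φ (BP.v 7 1))) = 2 * b + a ^ 2 := by
    have e1 := congrArg (evalKLRing a b) hv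
    have e2 := congrArg (evalKLRing a b) r2
    simp only [map_mul, map_neg, map_add, map_pow, map_ofNat, evalKLRing_kap,
      evalKLRing_lam] at e1 e2
    linear_combination 8 * e1 - e2
  -- The point `κ = 1`, `λ = 3` satisfies `2λ + κ² = 7`, so it is a zero of `v₁` with `κλ`
  -- invertible.
  refine isLandweberExactOfHeight_two
    (not_natCast_dvd_of_map_ne_zero (evalKLRing 1 1) fun h => ?_) (evalKLRing 1 3) ?_ ?_
    fun k _ π hp h1 hk hl h => ?_
  · have := hev 1 1
    rw [h] at this
    exact one_ne_zero (α := ZMod 7) (by linear_combination -5 * this - 2 * h7')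
  · linear_combination 5 * hev 1 3 + (5 - 17 * evalKLRing 1 3 (restriction _ (φ (BP.v 7 1)))) * h7'
  · rw [map_mul, evalKLRing_kap, evalKLRing_lam, one_mul]
    exact IsUnit.of_mul_eq_one 5 (by linear_combination 2 * h7')
  · have hp' : (7 : k) = 0 := by exact_mod_cast hp
    have h2 := two_mul_map_v_two (π := π.comp (restriction (ZLocal 7)).toRingHom) hφ R hp' h1
    have e1 := congrArg π hv
    have e2 := congrArg π r2
    have e3 := congrArg π r3
    have e4 := congrArg π r4
    have e5 := congrArg (fun f => π (restriction _ f)) hR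
    simp only [map_mul, map_neg, map_add, map_sub, map_pow, map_ofNat, h1] at e1 e2 e3 e4 e5
    have hlam : π (lam _) = 3 * π (kap _) ^ 2 := by
      linear_combination 4 * e2 - 32 * e1 - (π (lam _) + π (kap _) ^ 2) * hp'
    -- Substituting `λ = 3κ²` into the restriction map gives `x = 2κ⁴` and `z = 3κ³`.
    refine homEvalList_scale_ne_zero hp relSeven_homog hk 2 3 ?_ ?_ (by decide +kernel)
      (h2.symm.trans ?_)
    · change π (restriction _ R.x) = _
      push_cast
      linear_combination 3 * (256 * e5 + e4 - 4 * π (kap _) ^ 2 * hlam)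
        - (329 * π (restriction _ R.x) + 5 * π (kap _) ^ 4) * hp'
    · change π (restriction _ (G3 _)) = _
      push_cast
      linear_combination e3 + π (kap _) * hlam - π (restriction _ (G3 _)) * hp'
    · change 2 * π (restriction _ (φ (BP.v 7 2))) = 0
      rw [h, mul_zero]

end Seven

/-! ### Heights three and two for `p = 13` -/

section Thirteen
variable [Fact (Nat.Prime 13)] {φ : BP 13 →ₐ[ZLocal 13] GRing (ZLocal 13)}

theorem height_three_thirteen (hφ : ∀ x : BP 13, toRat 13 (φ x) = picardGenus (x : MURat)) :
    IsLandweberExactOfHeight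
      ((algebraMap (GRing (ZLocal 13)) (GRingLoc (ZLocal 13))).comp φ.toRingHom) 3 := by
  obtain ⟨R, hR⟩ := exists_reduction_thirteen hφ
  have h13 : ((13 : ℕ) : ZMod 13) = 0 := CharP.cast_eq_zero _ 13
  have h13' : (13 : ZMod 13) = 0 := by exact_mod_cast h13
  have hev (a b c : ZMod 13) : 9 * evalGRing a b c (φ (BP.v 13 1)) = 2 * a ^ 2 - 3 * c := by
    have := congrArg (evalGRing a b c) (nine_mul_v_one hφ)
    simpa only [map_mul, map_sub, map_pow, map_ofNat, evalGRing_G2, evalGRing_G4] using this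
  have hex (a b c : ZMod 13) : 3 * evalGRing a b c R.x = a := by
    have := congrArg (evalGRing a b c) hR
    rwa [map_mul, map_ofNat, evalGRing_G2] at this
  have hε0 : evalGRing 0 1 0 (φ (BP.v 13 1)) = 0 := by
    linear_combination 3 * hev 0 1 0 - 2 * evalGRing 0 1 0 (φ (BP.v 13 1)) * h13'
  have hε1 : evalGRing 3 1 6 (φ (BP.v 13 1)) = 0 := by
    linear_combination 3 * hev 3 1 6 - 2 * evalGRing 3 1 6 (φ (BP.v 13 1)) * h13'
  -- At `(3, 1, 6)` one has `v₁ = 0` and `x = z = 1`. At `(0, 1, 0)` also `v₂` vanishes, because `3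
  -- ∤ 56` forces a factor `x` in each monomial.
  refine isLandweberExactOfHeight_three R
    (not_natCast_dvd_of_map_ne_zero (evalGRing 0 0 1) fun h => ?_)
    (not_natCast_dvd_of_map_ne_zero (evalGRing 3 1 6) fun h => ?_) (evalGRing 0 1 0)
    hε0 ?_ (evalGRing_G3 _ _ _) fun B _ π hp h1 h2 hu => ?_
  · have := hev 0 0 1
    rw [h] at this
    exact one_ne_zero (α := ZMod 13) (by linear_combination 9 * this - 2 * h13')
  · rw [R.map_s hε1] at h
    have h2 := four_mul_map_v_two hφ R h13' hε1
    have hx : evalGRing 3 1 6 R.x = 1 := by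
      linear_combination 9 * hex 3 1 6 + (2 - 2 * evalGRing 3 1 6 R.x) * h13'
    rw [h, hx, evalGRing_G3, mul_zero] at h2
    exact homEvalList_scale_ne_zero h13 relThirteen_homog one_ne_zero 1 1 (by simp) (by simp)
      (by decide +kernel) h2.symm
  · have h2 := four_mul_map_v_two hφ R h13' hε0
    have hx : evalGRing 0 1 0 R.x = 0 := by
      linear_combination 9 * hex 0 1 0 - 2 * evalGRing 0 1 0 R.x * h13'
    simp [hx, homEvalList, relThirteen, -mul_eq_zero] at h2
    linear_combination 10 * h2 - 3 * evalGRing 0 1 0 (φ (BP.v 13 2)) * h13'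
  · have h := map_v_three_pow_eighteen hφ R (by exact_mod_cast hp) h1 h2
    exact (isUnit_pow_iff (by norm_num)).1 (h ▸ (hu.pow 4392).neg)

theorem height_two_thirteen (hφ : ∀ x : BP 13, toRat 13 (φ x) = picardGenus (x : MURat)) :
    IsLandweberExactOfHeight
      ((algebraMap (KLRing (ZLocal 13)) (KLRingLoc (ZLocal 13))).comp
        ((restriction (ZLocal 13)).toRingHom.comp φ.toRingHom)) 2 := by
  obtain ⟨R, hR⟩ := exists_reduction_thirteen hφ
  obtain ⟨r2, r3, r4⟩ := restriction_generators (p := 13) (by norm_num) (by norm_num)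
  have hv : 2304 * restriction _ (φ (BP.v 13 1)) =
      32 * lam (ZLocal 13) ^ 2 + 44 * lam _ * kap _ ^ 2 + 5 * kap _ ^ 4 := by
    have := congrArg (restriction (ZLocal 13)) (nine_mul_v_one hφ)
    simp only [map_mul, map_sub, map_pow, map_ofNat] at this
    linear_combination 256 * this - 3 * r4
      + 8 * (8 * restriction _ (G2 _) - (2 * lam _ + kap _ ^ 2)) * r2
  have h13 : ((13 : ℕ) : ZMod 13) = 0 := CharP.cast_eq_zero _ 13
  have h13' : (13 : ZMod 13) = 0 := by exact_mod_cast h13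
  have hev (a b : ZMod 13) : 2304 * evalKLRing a b (restriction _ (φ (BP.v 13 1))) =
      32 * b ^ 2 + 44 * b * a ^ 2 + 5 * a ^ 4 := by
    have e1 := congrArg (evalKLRing a b) hv
    simpa only [map_mul, map_add, map_pow, map_ofNat, evalKLRing_kap, evalKLRing_lam] using e1
  refine isLandweberExactOfHeight_two
    (not_natCast_dvd_of_map_ne_zero (evalKLRing 1 1) fun h => ?_) (evalKLRing 1 2) ?_ ?_
    fun k _ π hp h1 hk hl h => ?_
  · have := hev 1 1
    rw [h] at this
    exact one_ne_zero (α := ZMod 13) (by linear_combination -9 * this - 56 * h13')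
  · linear_combination 9 * hev 1 2
      + (153 - 1595 * evalKLRing 1 2 (restriction _ (φ (BP.v 13 1)))) * h13'
  · rw [map_mul, evalKLRing_kap, evalKLRing_lam, one_mul]
    exact IsUnit.of_mul_eq_one 7 (by linear_combination h13')
  · have hp' : (13 : k) = 0 := by exact_mod_cast hp
    have h2 := four_mul_map_v_two (π := π.comp (restriction (ZLocal 13)).toRingHom) hφ R hp' h1
    have h2' : 4 * (π.comp (restriction (ZLocal 13)).toRingHom) (φ (BP.v 13 2)) = 0 := by
      change 4 * π (restriction _ (φ (BP.v 13 2))) = 0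
      rw [h, mul_zero]
    have e1 := congrArg π hv
    have e2 := congrArg π r2
    have e3 := congrArg π r3
    have e5 := congrArg (fun f => π (restriction _ f)) hR
    simp only [map_mul, map_neg, map_add, map_pow, map_ofNat, h1] at e1 e2 e3 e5
    -- Modulo `13` the quadratic form `32λ² + 44λκ² + 5κ⁴` in `λ`, `κ²` splits, with roots `2` and
    -- `8` for `λ/κ²`. They give `(x, z) = (9κ², 10κ³)` and `(2κ², κ³)`.
    have hlam : (π (lam _) - 2 * π (kap _) ^ 2) * (π (lam _) - 8 * π (kap _) ^ 2) = 0 := by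
      linear_combination -11 * e1
        - (27 * π (lam _) ^ 2 + 38 * π (lam _) * π (kap _) ^ 2 + 3 * π (kap _) ^ 4) * hp'
    obtain hlam | hlam := mul_eq_zero.1 hlam
    · refine homEvalList_scale_ne_zero hp relThirteen_homog hk 9 10 ?_ ?_ (by decide +kernel)
        (h2.symm.trans h2')
      · change π (restriction _ R.x) = _
        push_cast
        linear_combination 6 * (8 * e5 + e2 - 2 * hlam)
          - (11 * π (restriction _ R.x) + 3 * π (kap _) ^ 2) * hp'
      · change π (restriction _ (G3 _)) = _
        push_cast
        linear_combination 5 * (e3 + π (kap _) * hlam) - 3 * π (restriction _ (G3 _)) * hp'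
    · refine homEvalList_scale_ne_zero hp relThirteen_homog hk 2 1 ?_ ?_ (by decide +kernel)
        (h2.symm.trans h2')
      · change π (restriction _ R.x) = _
        push_cast
        linear_combination 6 * (8 * e5 + e2 - 2 * hlam)
          - (11 * π (restriction _ R.x) + 8 * π (kap _) ^ 2) * hp'
      · change π (restriction _ (G3 _)) = _
        push_cast
        linear_combination 5 * (e3 + π (kap _) * hlam)
          - 3 * (π (restriction _ (G3 _)) - π (kap _) ^ 3) * hp'

end Thirteen

/-! ### The map between the localizations and the main theorem -/

section Restriction
variable {p : ℕ} [hp : Fact p.Prime]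

theorem exists_localized_restriction (h2 : ¬ p ∣ 2) (h3 : ¬ p ∣ 3) :
    ∃ f : GRingLoc (ZLocal p) →ₐ[ZLocal p] KLRingLoc (ZLocal p), ∀ g : GRing (ZLocal p),
      f (algebraMap (GRing (ZLocal p)) (GRingLoc (ZLocal p)) g)
        = algebraMap (KLRing (ZLocal p)) (KLRingLoc (ZLocal p)) (restriction (ZLocal p) g) := by
  -- `8 r(G₃) = κλ` is inverted in the target, so `r` extends over the inverse of `G₃`.
  have hu : IsUnit (algebraMap (KLRing (ZLocal p)) (KLRingLoc (ZLocal p))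
      (restriction (ZLocal p) (G3 _))) := by
    have h := IsLocalization.Away.algebraMap_isUnit (S := KLRingLoc (ZLocal p))
      (kap (ZLocal p) * lam (ZLocal p))
    have e := congrArg (algebraMap (KLRing (ZLocal p)) (KLRingLoc (ZLocal p)))
      (restriction_generators h2 h3).2.1
    rw [map_mul] at e
    rw [← e] at h
    exact isUnit_of_mul_isUnit_right h
  let r : GRing (ZLocal p) →ₐ[ZLocal p] KLRingLoc (ZLocal p) :=
    (IsScalarTower.toAlgHom (ZLocal p) (KLRing (ZLocal p)) (KLRingLoc (ZLocal p))).comp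
      (restriction (ZLocal p))
  refine ⟨IsLocalization.liftAlgHom (M := Submonoid.powers (G3 (ZLocal p))) (f := r) ?_,
    fun g => IsLocalization.lift_eq _ _⟩
  rintro ⟨_, n, rfl⟩
  change IsUnit (r (G3 _ ^ n))
  rw [map_pow]
  exact hu.pow n

end Restriction

theorem mainTheorem5 (p : ℕ) [Fact p.Prime] (hp : p = 7 ∨ p = 13) :
    -- the Picard genus restricts to a homomorphism `φ` from `BP_*` to `ℤ_(p)[G₂, G₃, G₄]`
    ∃ φ : BP p →ₐ[ZLocal p] GRing (ZLocal p),
      (∀ x : BP p, toRat p (φ x) = picardGenus (x : MURat)) ∧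
      -- the congruences modulo `(p, v_1, v_2)`
      (p = 7 → deltaC (ZLocal p) ^ 57 - G3 (ZLocal p) ^ 228 ∈ landweberIdeal φ.toRingHom 3) ∧
      (p = 13 → φ (BP.v p 3) ^ 18 + G3 (ZLocal p) ^ 4392 ∈ landweberIdeal φ.toRingHom 3) ∧
      -- the two Landweber exact algebras, with structure maps induced by `φ` and by `r ∘ φ`
      IsLandweberExactOfHeight
        ((algebraMap (GRing (ZLocal p)) (GRingLoc (ZLocal p))).comp φ.toRingHom) 3 ∧
      IsLandweberExactOfHeight
        ((algebraMap (KLRing (ZLocal p)) (KLRingLoc (ZLocal p))).comp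
          ((restriction (ZLocal p)).toRingHom.comp φ.toRingHom)) 2 ∧
      -- the homomorphism of `BP_*`-algebras between them that is induced by `r`
      ∃ f : GRingLoc (ZLocal p) →ₐ[ZLocal p] KLRingLoc (ZLocal p),
        (∀ g : GRing (ZLocal p),
          f (algebraMap (GRing (ZLocal p)) (GRingLoc (ZLocal p)) g)
            = algebraMap (KLRing (ZLocal p)) (KLRingLoc (ZLocal p)) (restriction (ZLocal p) g)) ∧
        f.toRingHom.comp
            ((algebraMap (GRing (ZLocal p)) (GRingLoc (ZLocal p))).comp φ.toRingHom)
          = (algebraMap (KLRing (ZLocal p)) (KLRingLoc (ZLocal p))).comp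
              ((restriction (ZLocal p)).toRingHom.comp φ.toRingHom) := by
  obtain ⟨φ, hφ⟩ := exists_integral_picardGenus (p := p) (by rcases hp with rfl | rfl <;> rfl)
  obtain ⟨f, hf⟩ := exists_localized_restriction (p := p)
    (by rcases hp with rfl | rfl <;> norm_num) (by rcases hp with rfl | rfl <;> norm_num)
  have hm (i : ℕ) (hi : i < 3) : Ideal.Quotient.mk (landweberIdeal φ.toRingHom 3)
      (φ (BP.v p i)) = 0 :=
    Ideal.Quotient.eq_zero_iff_mem.2 (mem_initialIdeal (fun i => φ (BP.v p i)) hi)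
  have hm0 := hm 0 (by norm_num)
  rw [BP.v, map_natCast, map_natCast] at hm0
  refine ⟨φ, hφ, ?_, ?_, ?_, ?_, f, hf, RingHom.ext fun x => hf _⟩
  · rintro rfl
    obtain ⟨R, hR⟩ := exists_reduction_seven hφ
    rw [← Ideal.Quotient.eq_zero_iff_mem, map_sub, map_pow, map_pow, sub_eq_zero]
    exact map_deltaC_pow hφ R hR (by exact_mod_cast hm0) (hm 1 (by norm_num)) (hm 2 (by norm_num))
  · rintro rfl
    obtain ⟨R, hR⟩ := exists_reduction_thirteen hφ
    rw [← Ideal.Quotient.eq_zero_iff_mem, map_add, map_pow, map_pow,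
      map_v_three_pow_eighteen hφ R (by exact_mod_cast hm0) (hm 1 (by norm_num))
        (hm 2 (by norm_num)), neg_add_cancel]
  · rcases hp with rfl | rfl
    exacts [height_three_seven hφ, height_three_thirteen hφ]
  · rcases hp with rfl | rfl
    exacts [height_two_seven hφ, height_two_thirteen hφ]
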